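/- Let $\xi_1,\xi_2,\dots$ be i.i.d. $\mathbb{Z}$-valued random variables whose common law $p(a)=\mathbb{P}(\xi_1=a)$ is symmetric, $p(a)=p(-a)$ for all $a\in\mathbb{Z}$; has exponential tails, i.e. there are $\beta>0$ and $C<\infty$ with $\mathbb{P}(|\xi_1|>t)\le Ce^{-\beta t}$ for all $t\in\{0,1,2,\dots\}$; and is irreducible and aperiodic in the sense that the differences $a-b$ with $p(a)>0$ and $p(b)>0$ generate the group $\mathbb{Z}$. For $w\in\mathbb{Z}$ let $\mathbb{P}_w$ be the law of the random walk $Z_n=w+\xi_1+\dots+\xi_n$ ($Z_0=w$), and for $w,z\in\mathbb{Z}$ put $$q_n(w,z)=\mathbb{P}_w(Z_n=z),\qquad u_n(w,z)=\mathbb{P}_w\bigl(Z_n=z,\ Z_k>0\text{ for }k=1,\dots,n\bigr).$$ Let $U$ be the renewal function of the strictly ascending ladder variables of the walk, $$U(z)=\mathbb{E}_0\,\#\bigl\{m\ge 0:\ Z_m<z\ \text{ and }\ Z_m>Z_k\text{ for all }0\le k<m\bigr\},\qquad z\in\{1,2,\dots\}.$$ Then $0<U(z)<\infty$ for every $z\ge1$,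 and $U$ has at most linear growth: there is $C'<\infty$ with $U(z)\le C'z$ for all $z\ge 1$. Moreover there is a constant $c>0$ such that for every $\epsilon\in(0,1/2)$ and every $K>0$, $$\lim_{n\to\infty}\ \frac{u_n(w,z)}{\dfrac{U(w)\,U(z)}{n}\,q_n(w,z)}=c$$ uniformly over integers $w,z$ with $0<w,z\le Kn^{\epsilon}$ (in particular $q_n(w,z)>0$ for all such $w,z$ once $n$ is large). -/

import Mathlib

open MeasureTheory ProbabilityTheory Filter
open scoped ENNReal

/-- The random walk on `ℤ` with steps `ξ 0, ξ 1, …` started at `w`: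
`Z_n = w + ξ 0 + ⋯ + ξ (n - 1)`.  The measure `P_w` of the walk started at `w` is realised by
following `walk ξ w` under the law `P` of the steps. -/
def walk {Ω : Type*} (ξ : ℕ → Ω → ℤ) (w : ℤ) (n : ℕ) (ω : Ω) : ℤ :=
  w + ∑ k ∈ Finset.range n, ξ k ω

/-- The transition function `q_n(w, z) = P_w(Z_n = z)`. -/
noncomputable def transProb {Ω : Type*} [MeasurableSpace Ω] (P : Measure Ω) (ξ : ℕ → Ω → ℤ)
    (n : ℕ) (w z : ℤ) : ℝ :=
  P.real {ω | walk ξ w n ω = z}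

/-- `u_n(w, z) = P_w(Z_n = z, Z_k > 0 for k = 1, …, n)`. -/
noncomputable def posTransProb {Ω : Type*} [MeasurableSpace Ω] (P : Measure Ω) (ξ : ℕ → Ω → ℤ)
    (n : ℕ) (w z : ℤ) : ℝ :=
  P.real {ω | walk ξ w n ω = z ∧ ∀ k : ℕ, 1 ≤ k → k ≤ n → 0 < walk ξ w k ω}

/-- `m` is a strictly ascending ladder time of the path `x`: `x m > x k` for all `k < m`
(in particular `m = 0` always is one). -/
def IsStrictLadderTime (x : ℕ → ℤ) (m : ℕ) : Prop :=
  ∀ k : ℕ, k < m → x k < x m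

/-- The number of strictly ascending ladder times `m ≥ 0` of the path `x` with `x m < z`. -/
noncomputable def ladderCount (x : ℕ → ℤ) (z : ℤ) : ℕ∞ :=
  {m : ℕ | x m < z ∧ IsStrictLadderTime x m}.encard

/-- The renewal function of the strictly ascending ladder variables of the walk started at `0`:
`U(z) = E #{m ≥ 0 : Z_m < z and m is a strictly ascending ladder time}`.
(An infinite expectation would be sent to `0`.) -/
noncomputable def ladderRenewal {Ω : Type*} [MeasurableSpace Ω] (P : Measure Ω)
    (ξ : ℕ → Ω → ℤ) (z : ℤ) : ℝ :=
  (∫⁻ ω, (ladderCount (fun m => walk ξ 0 m ω) z : ℝ≥0∞) ∂P).toReal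

/-- `a n i / b n i` tends to `c` as `n → ∞`, uniformly over `i` in the parameter set `W n`. -/
def RatioTendstoUniformly {ι : Type*} (W : ℕ → Set ι) (a b : ℕ → ι → ℝ) (c : ℝ) : Prop :=
  ∀ δ : ℝ, 0 < δ → ∀ᶠ n : ℕ in atTop, ∀ i ∈ W n, |a n i / b n i - c| < δ

/-!
The killed walk is treated through an exact identity for its transition probabilities.

Let `T` be the matrix on `ℕ` of one step of the walk killed when it steps to `(-∞, 0]`, so that
`u_n = T ^ n`, and let `L k` and `R k` be the parts of the matrix of `k + 1` free steps that go
weakly down (to a positive site) and strictly up.  A product `T * L k` or `R k * T` only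
passes through points of the half line, whence `L (k + 1) + R (k + 1) = T * L k + R k * T`
(`freeDown_add_freeUp_succ`), and an induction in the semiring of nonnegative matrices turns this
into `n * u_n = ∑ (L k * u_{n-1-k} + u_{n-1-k} * R k)` (`natCast_mul_killedPow`).  In coordinates,
`n u_n(w, z) = ∑_{m < n} (∑_{1 ≤ i ≤ w} q_{n-m}(i - w) u_m(i, z)
                          + ∑_{0 ≤ i < z} u_m(w, i) q_{n-m}(z - i))`.

Only times `m` that are small compared with `n` matter on the right, and there the local limit
theorem (`exists_local_limit`) lets `q_{n-m}` be replaced by `q_n(w, z)`.  So `n u_n(w, z)` is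
asymptotic to `q_n(w, z)` times the sum over `m` of the coefficients, a sum of Green functions.
Decomposing paths at their last visit to `1` (`killedPow_succ_succ`) gives
`G(w + 1, z + 1) = G(w, z) + c α(w) α(z)`, without the term `G(w, z)` if `w = 0`, where
`c = G(1, 1)` and `α(x) = U(x + 1) - U(x)`, and a telescoping sum identifies that
coefficient sum as `c U(w) U(z)` (`sum_greenFun_add_sum_greenFun`).

The times `m ≥ M` are controlled by `u_m(w, z) ≤ B U(w) U(z) m ^ (-3/2)` (`killedPow_toReal_le`).
This follows by cutting a path into three pieces, from `q_k ≤ D k ^ (-1/2)` for the middle piece and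
the bound `2 c U(w) (n + 1) ^ (-1/2)` for the probability to stay positive.  The latter comes from
the key identity once more: for the starting point `0` it gives `2 n a_n ≤ ∑_{m < n} a_m` for the
survival probabilities `a_n`, because a symmetric walk is positive with probability at most `1 / 2`
at any time; the same decomposition at the last visit to `1` carries it over to general `w`
(`sum_survival_le`).

Finally `U(z) ≤ z` since ladder heights are distinct, and `c < ∞` because an excursion from `y > 0`
that stays above `y`, preceded by a jump from `0` to `y`, is counted by `α(y)`.
-/

/-! ### Infinite nonnegative matrices -/

/-- Infinite matrices indexed by `ℕ` with entries in `[0, ∞]`.  All sums converge, so that matrix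
multiplication makes them a semiring. -/
@[ext] structure KernelMat where
  /-- The entries of the matrix. -/
  entry : ℕ → ℕ → ℝ≥0∞

namespace KernelMat

instance : CoeFun KernelMat fun _ => ℕ → ℕ → ℝ≥0∞ := ⟨entry⟩

noncomputable instance : Zero KernelMat := ⟨⟨fun _ _ => 0⟩⟩

noncomputable instance : Add KernelMat := ⟨fun A B => ⟨fun i j => A i j + B i j⟩⟩

noncomputable instance : One KernelMat := ⟨⟨fun i j => if i = j then 1 else 0⟩⟩

noncomputable instance : Mul KernelMat := ⟨fun A B => ⟨fun i j => ∑' k, A i k * B k j⟩⟩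

lemma ext_apply {A B : KernelMat} (h : ∀ i j, A i j = B i j) : A = B :=
  KernelMat.ext (funext fun i => funext fun j => h i j)

lemma mul_apply (A B : KernelMat) (i j : ℕ) : (A * B) i j = ∑' k, A i k * B k j := rfl

lemma one_apply (i j : ℕ) : (1 : KernelMat) i j = if i = j then 1 else 0 := rfl

lemma add_apply (A B : KernelMat) (i j : ℕ) : (A + B) i j = A i j + B i j := rfl

lemma zero_apply (i j : ℕ) : (0 : KernelMat) i j = 0 := rfl

noncomputable instance : Semiring KernelMat where
  add_assoc A B C := ext_apply fun i j => add_assoc _ _ _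
  zero_add A := ext_apply fun i j => zero_add _
  add_zero A := ext_apply fun i j => add_zero _
  add_comm A B := ext_apply fun i j => add_comm _ _
  mul_assoc A B C := by
    refine ext_apply fun i j => ?_
    simp only [mul_apply, ← ENNReal.tsum_mul_right, ← ENNReal.tsum_mul_left]
    rw [ENNReal.tsum_comm]
    simp only [mul_assoc]
  one_mul A := by
    refine ext_apply fun i j => ?_
    rw [mul_apply, tsum_eq_single i]
    · simp [one_apply]
    · intro k hk; simp [one_apply, hk.symm]
  mul_one A := by
    refine ext_apply fun i j => ?_
    rw [mul_apply, tsum_eq_single j]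
    · simp [one_apply]
    · intro k hk; simp [one_apply, hk]
  left_distrib A B C := by
    refine ext_apply fun i j => ?_; simp only [mul_apply, add_apply, mul_add, ENNReal.tsum_add]
  right_distrib A B C := by
    refine ext_apply fun i j => ?_; simp only [mul_apply, add_apply, add_mul, ENNReal.tsum_add]
  zero_mul A := ext_apply fun i j => by simp [mul_apply, zero_apply]
  mul_zero A := ext_apply fun i j => by simp [mul_apply, zero_apply]
  nsmul := nsmulRec

lemma sum_apply {ι : Type*} (s : Finset ι) (A : ι → KernelMat) (i j : ℕ) :
    (∑ a ∈ s, A a) i j = ∑ a ∈ s, A a i j := by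
  classical
  induction s using Finset.induction_on with
  | empty => simp [zero_apply]
  | insert a s ha ih => rw [Finset.sum_insert ha, Finset.sum_insert ha, add_apply, ih]

lemma natCast_mul_apply (n : ℕ) (A : KernelMat) (i j : ℕ) :
    ((n : KernelMat) * A) i j = n * A i j := by
  induction n with
  | zero => simp [zero_apply]
  | succ n ih => rw [Nat.cast_succ, add_mul, add_apply, ih, one_mul]; push_cast; ring

end KernelMat

/-- The algebra behind the key identity: the left side is a coefficient of the Euler derivative of
the geometric series of `T`.  In a ring, the hypotheses say `(1 - s T) L(s) + R(s) (1 - s T) = s T`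
for
the generating functions, and multiplying by `(1 - s T)⁻¹` on both sides gives the claim; the proof
below avoids subtraction. -/
theorem natCast_mul_pow_eq_sum {A : Type*} [Semiring A] {T : A} {L R : ℕ → A}
    (h0 : L 0 + R 0 = T)
    (hstep : ∀ k, L (k + 1) + R (k + 1) = T * L k + R k * T) (n : ℕ) :
    (n : A) * T ^ n
      = ∑ k ∈ Finset.range n, (L k * T ^ (n - 1 - k) + T ^ (n - 1 - k) * R k) := by
  -- the two halves of the sum, and how they grow with `n`
  set E : ℕ → A := fun n => ∑ k ∈ Finset.range n, L k * T ^ (n - 1 - k) with hE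
  set F : ℕ → A := fun n => ∑ k ∈ Finset.range n, T ^ (n - 1 - k) * R k with hF
  have hE1 : ∀ n, E (n + 1) = E n * T + L n := by
    intro n
    simp only [hE, Finset.sum_range_succ, Finset.sum_mul]
    congr 1
    · refine Finset.sum_congr rfl fun k hk => ?_
      have hk' := Finset.mem_range.1 hk
      rw [mul_assoc, ← pow_succ]; congr 2; omega
    · simp
  have hF1 : ∀ n, F (n + 1) = T * F n + R n := by
    intro n
    simp only [hF, Finset.sum_range_succ, Finset.mul_sum]
    congr 1
    · refine Finset.sum_congr rfl fun k hk => ?_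
      have hk' := Finset.mem_range.1 hk
      rw [← mul_assoc, ← pow_succ']; congr 2; omega
    · simp
  have hER : ∀ n, E (n + 1) + R n = T ^ (n + 1) + T * E n := by
    intro n
    induction n with
    | zero => simp [hE, h0]
    | succ n ih =>
      calc E (n + 1 + 1) + R (n + 1) = E (n + 1) * T + (L (n + 1) + R (n + 1)) := by
            rw [hE1 (n + 1), add_assoc]
        _ = (E (n + 1) + R n) * T + T * L n := by rw [hstep, add_mul]; abel
        _ = T ^ (n + 1 + 1) + T * E (n + 1) := by
            rw [ih, hE1 n, add_mul, mul_add, ← pow_succ, mul_assoc, add_assoc]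
  rw [Finset.sum_add_distrib]
  change (n : A) * T ^ n = E n + F n
  induction n with
  | zero => simp [hE, hF]
  | succ n ih =>
    calc ((n + 1 : ℕ) : A) * T ^ (n + 1) = T * ((n : A) * T ^ n) + T ^ (n + 1) := by
          rw [Nat.cast_succ, add_mul, one_mul, pow_succ' T n, ← mul_assoc, ← mul_assoc,
            Nat.cast_comm]
      _ = (E (n + 1) + R n) + T * F n := by rw [ih, hER, mul_add]; abel
      _ = E (n + 1) + F (n + 1) := by rw [hF1, add_assoc, add_comm (R n)]

/-! ### The walk and the killed walk -/

/-- The law of the sum of `n` independent steps with law `p`. -/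
noncomputable def stepPow (p : ℤ → ℝ≥0∞) : ℕ → ℤ → ℝ≥0∞
  | 0 => Pi.single 0 1
  | n + 1 => fun x => ∑' y, stepPow p n y * p (x - y)

/-- The transition matrix on `ℕ` of the walk that is killed when it steps to a nonpositive
site.  The state `0` is kept as a starting point only: its column vanishes. -/
noncomputable def killedStep (p : ℤ → ℝ≥0∞) : KernelMat :=
  ⟨fun y x => if 0 < x then p ((x : ℤ) - y) else 0⟩

/-- The `n`-step transition probabilities of the killed walk. -/
noncomputable def killedPow (p : ℤ → ℝ≥0∞) (n : ℕ) : KernelMat := killedStep p ^ n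

lemma tsum_int_eq_tsum_nat {f : ℤ → ℝ≥0∞} (hf : ∀ x < 0, f x = 0) :
    ∑' x, f x = ∑' n : ℕ, f n := by
  refine (Function.Injective.tsum_eq (g := fun n : ℕ => (n : ℤ)) Nat.cast_injective ?_).symm
  intro x hx
  by_contra h
  refine hx (hf x ?_)
  by_contra h'
  exact h ⟨x.toNat, by simp at h'; simp [h']⟩

lemma stepPow_one (p : ℤ → ℝ≥0∞) : stepPow p 1 = p := by
  funext x
  change ∑' y, (Pi.single 0 1 : ℤ → ℝ≥0∞) y * p (x - y) = p x
  rw [tsum_eq_single 0]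
  · simp
  · intro y hy; simp [hy]

lemma stepPow_succ (p : ℤ → ℝ≥0∞) (n : ℕ) (x : ℤ) :
    stepPow p (n + 1) x = ∑' y, stepPow p n y * p (x - y) := rfl

/-- The part of the matrix of `k + 1` free steps that goes weakly down to a positive site. -/
noncomputable def freeDown (p : ℤ → ℝ≥0∞) (k : ℕ) : KernelMat :=
  ⟨fun w z => if 0 < z ∧ z ≤ w then stepPow p (k + 1) ((z : ℤ) - w) else 0⟩

/-- The part of the matrix of `k + 1` free steps that goes strictly up. -/
noncomputable def freeUp (p : ℤ → ℝ≥0∞) (k : ℕ) : KernelMat :=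
  ⟨fun w z => if w < z then stepPow p (k + 1) ((z : ℤ) - w) else 0⟩

lemma freeDown_add_freeUp_zero (p : ℤ → ℝ≥0∞) : freeDown p 0 + freeUp p 0 = killedStep p := by
  refine KernelMat.ext_apply fun w z => ?_
  rw [KernelMat.add_apply]
  simp only [freeDown, freeUp, killedStep, zero_add, stepPow_one]
  by_cases hz : 0 < z
  · by_cases h : z ≤ w
    · simp [hz, h, not_lt.2 h]
    · simp [hz, h, not_le.1 h]
  · have : z = 0 := by omega
    simp [this]

/-- One further step of the free walk: in a half line, the products of the killed step with the
downward part, on the left, and with the upward part, on the right, never leave the half line. -/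
lemma freeDown_add_freeUp_succ (p : ℤ → ℝ≥0∞) (k : ℕ) :
    freeDown p (k + 1) + freeUp p (k + 1)
      = killedStep p * freeDown p k + freeUp p k * killedStep p := by
  refine KernelMat.ext_apply fun w z => ?_
  simp only [KernelMat.add_apply, KernelMat.mul_apply]
  by_cases hz : 0 < z
  swap
  · have : z = 0 := by omega
    simp [this, freeDown, freeUp, killedStep]
  have hL : freeDown p (k + 1) w z + freeUp p (k + 1) w z
      = stepPow p (k + 1 + 1) ((z : ℤ) - w) := by
    by_cases h : z ≤ w
    · simp [freeDown, freeUp, hz, h, not_lt.2 h]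
    · simp [freeDown, freeUp, h, not_le.1 h]
  rw [hL, stepPow_succ]
  -- the intermediate point is summed over `ℤ`; it is split at `z - w` after the reflection
  -- that exchanges the first and the last factor
  have hsplit : ∀ y : ℤ, stepPow p (k + 1) y * p ((z : ℤ) - w - y)
      = (if y ≤ 0 then stepPow p (k + 1) y * p ((z : ℤ) - w - y) else 0)
        + (if 0 < y then stepPow p (k + 1) y * p ((z : ℤ) - w - y) else 0) := by
    intro y
    by_cases h : y ≤ 0
    · simp [h, not_lt.2 h]
    · simp [h, not_le.1 h]
  rw [tsum_congr hsplit, ENNReal.tsum_add]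
  congr 1
  · rw [← (Equiv.subLeft (z : ℤ)).tsum_eq, tsum_int_eq_tsum_nat]
    · refine tsum_congr fun y => ?_
      simp only [Equiv.subLeft_apply, killedStep, freeDown]
      by_cases h : z ≤ y
      · have h0 : 0 < y := by omega
        have h1 : (z : ℤ) - y ≤ 0 := by omega
        simp only [h1, h0, hz, h, and_self, if_true]
        rw [mul_comm]; congr 2; ring
      · have h1 : ¬ (z : ℤ) - y ≤ 0 := by omega
        simp [h1, h]
    · intro x hx
      have : ¬ (z : ℤ) - x ≤ 0 := by omega
      simp [this]
  · rw [← (Equiv.subRight (w : ℤ)).tsum_eq, tsum_int_eq_tsum_nat]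
    · refine tsum_congr fun y => ?_
      simp only [Equiv.subRight_apply, killedStep, freeUp, hz, if_true]
      by_cases h : w < y
      · have h1 : (0 : ℤ) < (y : ℤ) - w := by omega
        simp only [h1, h, if_true]
        congr 2; ring
      · have h1 : ¬ (0 : ℤ) < (y : ℤ) - w := by omega
        simp only [h1, h, if_false, zero_mul]
    · intro x hx
      have : ¬ (0 : ℤ) < x - w := by omega
      simp only [Equiv.subRight_apply, this, if_false]

/-- The key identity: `n` times the `n`-step matrix of the killed walk is a convolution of free
steps with shorter killed walks. -/
theorem natCast_mul_killedPow (p : ℤ → ℝ≥0∞) (n : ℕ) :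
    (n : KernelMat) * killedPow p n = ∑ k ∈ Finset.range n,
      (freeDown p k * killedPow p (n - 1 - k) + killedPow p (n - 1 - k) * freeUp p k) :=
  natCast_mul_pow_eq_sum (freeDown_add_freeUp_zero p) (freeDown_add_freeUp_succ p) n

/-! ### Symmetry, path decomposition and total mass -/

section StepPow

variable {p : ℤ → ℝ≥0∞}

lemma tsum_nat_le_tsum_int (f : ℤ → ℝ≥0∞) : ∑' n : ℕ, f n ≤ ∑' x, f x :=
  ENNReal.tsum_comp_le_tsum_of_injective Nat.cast_injective f

lemma tsum_int_sub_right (f : ℤ → ℝ≥0∞) (x : ℤ) : ∑' y, f (y - x) = ∑' y, f y :=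
  (Equiv.subRight x).tsum_eq f

lemma tsum_stepPow (hp : ∑' x, p x = 1) (n : ℕ) : ∑' x, stepPow p n x = 1 := by
  induction n with
  | zero =>
    change ∑' x, (Pi.single 0 1 : ℤ → ℝ≥0∞) x = 1
    exact tsum_pi_single 0 1
  | succ n ih =>
    simp only [stepPow_succ]
    rw [ENNReal.tsum_comm]
    simp only [ENNReal.tsum_mul_left, tsum_int_sub_right, hp, mul_one, ih]

lemma stepPow_le_one (hp : ∑' x, p x = 1) (n : ℕ) (x : ℤ) : stepPow p n x ≤ 1 :=
  (ENNReal.le_tsum x).trans (tsum_stepPow hp n).le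

lemma stepPow_neg (hs : ∀ x, p (-x) = p x) (n : ℕ) (x : ℤ) :
    stepPow p n (-x) = stepPow p n x := by
  induction n generalizing x with
  | zero =>
    change (Pi.single 0 1 : ℤ → ℝ≥0∞) (-x) = (Pi.single 0 1 : ℤ → ℝ≥0∞) x
    simp [Pi.single_apply]
  | succ n ih =>
    rw [stepPow_succ, stepPow_succ, ← (Equiv.neg ℤ).tsum_eq]
    refine tsum_congr fun y => ?_
    rw [Equiv.neg_apply, ih, ← hs (x - y)]
    congr 2; ring

/-- By symmetry the walk is strictly positive at a given time with probability at most `1 / 2`. -/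
lemma two_mul_tsum_stepPow_pos_le (hp : ∑' x, p x = 1) (hs : ∀ x, p (-x) = p x) (n : ℕ) :
    2 * ∑' d : ℕ, stepPow p n ((d : ℤ) + 1) ≤ 1 := by
  have h := tsum_stepPow hp n
  rw [tsum_of_nat_of_neg_add_one ENNReal.summable ENNReal.summable] at h
  rw [← h, two_mul]
  refine add_le_add ?_ ?_
  · exact ENNReal.tsum_comp_le_tsum_of_injective (f := fun d : ℕ => d + 1)
      (add_left_injective 1) (fun m : ℕ => stepPow p n (m : ℤ))
  · simp only [stepPow_neg hs, le_refl]

end StepPow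

section Killed

variable {p : ℤ → ℝ≥0∞}

lemma killedPow_zero_apply (p : ℤ → ℝ≥0∞) (w z : ℕ) :
    killedPow p 0 w z = if w = z then 1 else 0 := by
  rw [killedPow, pow_zero, KernelMat.one_apply]

lemma killedPow_succ_apply (p : ℤ → ℝ≥0∞) (n w z : ℕ) :
    killedPow p (n + 1) w z = ∑' y, killedPow p n w y * killedStep p y z := by
  rw [killedPow, pow_succ, KernelMat.mul_apply]; rfl

lemma killedPow_add_apply (p : ℤ → ℝ≥0∞) (m n w z : ℕ) :
    killedPow p (m + n) w z = ∑' y, killedPow p m w y * killedPow p n y z := by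
  rw [killedPow, pow_add, KernelMat.mul_apply]; rfl

lemma killedStep_zero_right (p : ℤ → ℝ≥0∞) (y : ℕ) : killedStep p y 0 = 0 := by
  simp [killedStep]

lemma killedPow_succ_zero_right (p : ℤ → ℝ≥0∞) (n w : ℕ) : killedPow p (n + 1) w 0 = 0 := by
  rw [killedPow_succ_apply]; simp [killedStep_zero_right]

lemma killedPow_zero_right (p : ℤ → ℝ≥0∞) (n : ℕ) {w : ℕ} (hw : 0 < w) :
    killedPow p n w 0 = 0 := by
  cases n with
  | zero => simp [killedPow_zero_apply, hw.ne']
  | succ n => exact killedPow_succ_zero_right p n w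

lemma killedPow_le_stepPow (p : ℤ → ℝ≥0∞) (n w z : ℕ) :
    killedPow p n w z ≤ stepPow p n ((z : ℤ) - w) := by
  induction n generalizing z with
  | zero =>
    rw [killedPow_zero_apply]
    split_ifs with h
    · subst h
      change _ ≤ (Pi.single 0 1 : ℤ → ℝ≥0∞) _
      simp
    · exact zero_le
  | succ n ih =>
    rw [killedPow_succ_apply, stepPow_succ, ← tsum_int_sub_right _ (w : ℤ)]
    refine le_trans ?_ (tsum_nat_le_tsum_int _)
    refine ENNReal.tsum_le_tsum fun y => mul_le_mul' (ih y) ?_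
    simp only [killedStep]
    split_ifs
    · apply le_of_eq; congr 1; ring
    · exact zero_le

lemma killedPow_symm (hs : ∀ x, p (-x) = p x) (n : ℕ) {w z : ℕ} (hw : 0 < w) (hz : 0 < z) :
    killedPow p n w z = killedPow p n z w := by
  induction n generalizing w z with
  | zero => simp only [killedPow_zero_apply, eq_comm]
  | succ n ih =>
    have h1 : killedPow p (n + 1) z w = ∑' y, killedStep p z y * killedPow p n y w := by
      rw [killedPow, pow_succ', KernelMat.mul_apply]; rfl
    rw [killedPow_succ_apply, h1]
    refine tsum_congr fun y => ?_
    rcases Nat.eq_zero_or_pos y with rfl | hy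
    · rw [killedPow_zero_right p n hw, killedStep_zero_right, zero_mul, zero_mul]
    · rw [ih hw hy, mul_comm]
      congr 1
      simp only [killedStep, hy, hz, if_true]
      rw [← hs]; congr 1; ring

/-- Decomposition at the last visit to `1`: either the killed walk does not visit `1` at all, and
then it is a shifted killed walk, or it is cut at its last visit to `1`. -/
lemma killedPow_succ_succ (p : ℤ → ℝ≥0∞) (n w z : ℕ) :
    killedPow p n (w + 1) (z + 1) = (if 0 < w then killedPow p n w z else 0)
      + ∑ m ∈ Finset.range (n + 1), killedPow p m (w + 1) 1 * killedPow p (n - m) 0 z := by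
  induction n generalizing z with
  | zero =>
    simp only [killedPow_zero_apply, zero_add, Finset.range_one, Finset.sum_singleton, Nat.sub_zero]
    rcases Nat.eq_zero_or_pos w with rfl | hw
    · simp [eq_comm]
    · simp [hw, hw.ne']
  | succ n ih =>
    rw [Finset.sum_range_succ, Nat.sub_self, killedPow_zero_apply]
    rcases Nat.eq_zero_or_pos z with rfl | hz
    · rw [Finset.sum_eq_zero]
      · simp [killedPow_succ_zero_right]
      · intro m hm
        have hm' := Finset.mem_range.1 hm
        rw [Nat.succ_sub (by omega), killedPow_succ_zero_right, mul_zero]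
    · rw [if_neg hz.ne, mul_zero, add_zero, killedPow_succ_apply,
        tsum_eq_zero_add' ENNReal.summable, killedPow_zero_right p n (Nat.succ_pos w),
        zero_mul, zero_add]
      have h1 : ∀ y, killedPow p n (w + 1) (y + 1) * killedStep p (y + 1) (z + 1)
          = (if 0 < w then killedPow p n w y * killedStep p y z else 0)
            + ∑ m ∈ Finset.range (n + 1), killedPow p m (w + 1) 1 *
                (killedPow p (n - m) 0 y * killedStep p y z) := by
        intro y
        have h2 : killedStep p (y + 1) (z + 1) = killedStep p y z := by
          simp [killedStep, hz]
        rw [h2, ih, add_mul, Finset.sum_mul, ite_mul, zero_mul]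
        simp only [mul_assoc]
      rw [tsum_congr h1, ENNReal.tsum_add]
      congr 1
      · split_ifs
        · rw [killedPow_succ_apply]
        · simp
      · rw [Summable.tsum_finsetSum fun _ _ => ENNReal.summable]
        refine Finset.sum_congr rfl fun m hm => ?_
        have hm' := Finset.mem_range.1 hm
        rw [ENNReal.tsum_mul_left, Nat.succ_sub (by omega), killedPow_succ_apply]

/-! ### Green function and renewal function -/

/-- The Green function of the killed walk. -/
noncomputable def greenFun (p : ℤ → ℝ≥0∞) (w z : ℕ) : ℝ≥0∞ := ∑' n, killedPow p n w z

/-- The renewal function: the Green function of the walk from `0`, killed when it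
returns to `(-∞, 0]`, summed over the sites below `z`. -/
noncomputable def renewal (p : ℤ → ℝ≥0∞) (z : ℕ) : ℝ≥0∞ := ∑ x ∈ Finset.range z, greenFun p 0 x

lemma renewal_succ (p : ℤ → ℝ≥0∞) (z : ℕ) : renewal p (z + 1) = renewal p z + greenFun p 0 z :=
  Finset.sum_range_succ _ _

lemma renewal_mono (p : ℤ → ℝ≥0∞) : Monotone (renewal p) :=
  monotone_nat_of_le_succ fun z => by rw [renewal_succ]; exact le_self_add

lemma greenFun_zero_right (p : ℤ → ℝ≥0∞) {w : ℕ} (hw : 0 < w) : greenFun p w 0 = 0 := by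
  simp [greenFun, killedPow_zero_right p _ hw]

lemma greenFun_symm (hs : ∀ x, p (-x) = p x) {w z : ℕ} (hw : 0 < w) (hz : 0 < z) :
    greenFun p w z = greenFun p z w :=
  tsum_congr fun n => killedPow_symm hs n hw hz

lemma ENNReal.tsum_sum_range_mul (f g : ℕ → ℝ≥0∞) :
    ∑' n, ∑ m ∈ Finset.range (n + 1), f m * g (n - m) = (∑' n, f n) * ∑' n, g n := by
  rw [← ENNReal.tsum_mul_right]
  simp only [← ENNReal.tsum_mul_left]
  rw [← ENNReal.tsum_prod, ← Finset.HasAntidiagonal.sigmaAntidiagonalEquivProd.tsum_eq,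
    ENNReal.tsum_sigma']
  refine tsum_congr fun n => ?_
  rw [← Finset.Nat.sum_antidiagonal_eq_sum_range_succ (fun i j => f i * g j), tsum_fintype]
  exact (Finset.sum_coe_sort (Finset.HasAntidiagonal.antidiagonal n) fun x => f x.1 * g x.2).symm

lemma greenFun_succ_succ (p : ℤ → ℝ≥0∞) (w z : ℕ) :
    greenFun p (w + 1) (z + 1) = (if 0 < w then greenFun p w z else 0)
      + greenFun p (w + 1) 1 * greenFun p 0 z := by
  have h : ∑' n, killedPow p n (w + 1) (z + 1) = ∑' n, _ :=
    tsum_congr fun n => killedPow_succ_succ p n w z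
  rw [ENNReal.tsum_add, ENNReal.tsum_sum_range_mul (fun m => killedPow p m (w + 1) 1)
    (fun m => killedPow p m 0 z)] at h
  rw [greenFun, h]
  congr 1
  split_ifs
  · rfl
  · simp

lemma greenFun_succ_one (hs : ∀ x, p (-x) = p x) (w : ℕ) :
    greenFun p (w + 1) 1 = greenFun p 1 1 * greenFun p 0 w := by
  rw [greenFun_symm hs (Nat.succ_pos w) one_pos]
  simpa using greenFun_succ_succ p 0 w

lemma greenFun_succ_succ' (hs : ∀ x, p (-x) = p x) (w z : ℕ) :
    greenFun p (w + 1) (z + 1) = (if 0 < w then greenFun p w z else 0)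
      + greenFun p 1 1 * (greenFun p 0 w * greenFun p 0 z) := by
  rw [greenFun_succ_succ, greenFun_succ_one hs, mul_assoc]

/-- The Green function of the killed walk, summed along the two half lines that appear in the key
identity, is a multiple of the product of the renewal functions. -/
theorem sum_greenFun_add_sum_greenFun (hs : ∀ x, p (-x) = p x) (w z : ℕ) (hw : 0 < w)
    (hz : 0 < z) :
    ∑ i ∈ Finset.range w, greenFun p (i + 1) z + ∑ i ∈ Finset.range z, greenFun p w i
      = greenFun p 1 1 * (renewal p w * renewal p z) := by
  -- descent along the diagonal
  have key : ∀ w z : ℕ, (∑ i ∈ Finset.range (w + 1), greenFun p (i + 1) (z + 1)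
        + ∑ i ∈ Finset.range (z + 1), greenFun p (w + 1) i)
      = (if 0 < w ∧ 0 < z then
          ∑ i ∈ Finset.range w, greenFun p (i + 1) z + ∑ i ∈ Finset.range z, greenFun p w i
          else 0)
        + greenFun p 1 1 * (greenFun p 0 z * renewal p (w + 1) + greenFun p 0 w * renewal p z) := by
    intro w z
    have h1 : ∑ i ∈ Finset.range (w + 1), greenFun p (i + 1) (z + 1)
        = (if 0 < w ∧ 0 < z then ∑ i ∈ Finset.range w, greenFun p (i + 1) z else 0)
          + greenFun p 1 1 * (greenFun p 0 z * renewal p (w + 1)) := by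
      rw [Finset.sum_congr rfl fun i _ => greenFun_succ_succ' hs i z, Finset.sum_add_distrib]
      congr 1
      · rw [Finset.sum_range_succ']
        rcases Nat.eq_zero_or_pos w with rfl | hw
        · simp
        · rcases Nat.eq_zero_or_pos z with rfl | hz
          · simp [greenFun_zero_right]
          · simp [hw, hz]
      · rw [renewal, ← Finset.mul_sum, ← Finset.sum_mul, mul_comm (greenFun p 0 z)]
    have h2 : ∑ i ∈ Finset.range (z + 1), greenFun p (w + 1) i
        = (if 0 < w ∧ 0 < z then ∑ i ∈ Finset.range z, greenFun p w i else 0)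
          + greenFun p 1 1 * (greenFun p 0 w * renewal p z) := by
      rw [Finset.sum_range_succ', greenFun_zero_right p (Nat.succ_pos w), add_zero]
      rw [Finset.sum_congr rfl fun i _ => greenFun_succ_succ' hs w i, Finset.sum_add_distrib]
      congr 1
      · rcases Nat.eq_zero_or_pos w with rfl | hw
        · simp
        · rcases Nat.eq_zero_or_pos z with rfl | hz
          · simp
          · simp [hw, hz]
      · rw [renewal, ← Finset.mul_sum, ← Finset.mul_sum]
    rw [h1, h2, mul_add]
    split_ifs <;> ring
  obtain ⟨w, rfl⟩ := Nat.exists_eq_succ_of_ne_zero hw.ne'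
  obtain ⟨z, rfl⟩ := Nat.exists_eq_succ_of_ne_zero hz.ne'
  simp only [Nat.succ_eq_add_one] at *
  clear hw hz
  induction w generalizing z with
  | zero =>
    rw [key, renewal_succ p z]
    simp [renewal]
    ring
  | succ w ih =>
    rw [key]
    rcases Nat.eq_zero_or_pos z with rfl | hz
    · simp [renewal]; ring
    · obtain ⟨z, rfl⟩ := Nat.exists_eq_succ_of_ne_zero hz.ne'
      simp only [Nat.succ_eq_add_one] at *
      rw [if_pos ⟨Nat.succ_pos w, hz⟩, ih, renewal_succ p (z + 1), renewal_succ p (w + 1)]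
      ring

end Killed

/-! ### Survival probabilities -/

section Survival

variable {p : ℤ → ℝ≥0∞}

/-- The probability that the killed walk from `w` is alive at time `n`. -/
noncomputable def survival (p : ℤ → ℝ≥0∞) (n w : ℕ) : ℝ≥0∞ := ∑' z, killedPow p n w z

lemma survival_zero (p : ℤ → ℝ≥0∞) (w : ℕ) : survival p 0 w = 1 := by
  simp only [survival, killedPow_zero_apply]
  exact tsum_ite_eq' w _

lemma tsum_killedStep_le (hp : ∑' x, p x = 1) (y : ℕ) : ∑' z, killedStep p y z ≤ 1 := by
  rw [← hp, ← tsum_int_sub_right p (y : ℤ)]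
  refine le_trans (ENNReal.tsum_le_tsum fun z => ?_) (tsum_nat_le_tsum_int _)
  simp only [killedStep]
  split_ifs
  · exact le_rfl
  · exact zero_le

lemma survival_succ_le (hp : ∑' x, p x = 1) (n w : ℕ) : survival p (n + 1) w ≤ survival p n w := by
  simp only [survival, killedPow_succ_apply]
  rw [ENNReal.tsum_comm]
  refine ENNReal.tsum_le_tsum fun y => ?_
  rw [ENNReal.tsum_mul_left]
  exact mul_le_of_le_one_right' (tsum_killedStep_le hp y)

lemma survival_antitone (hp : ∑' x, p x = 1) (w : ℕ) : Antitone fun n => survival p n w :=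
  antitone_nat_of_succ_le fun n => survival_succ_le hp n w

lemma survival_le_one (hp : ∑' x, p x = 1) (n w : ℕ) : survival p n w ≤ 1 :=
  (survival_antitone hp w (Nat.zero_le n)).trans (survival_zero p w).le

/-- The key identity from the starting point `0`, summed over the end points. -/
lemma two_mul_natCast_mul_survival_zero_le (hp : ∑' x, p x = 1) (hs : ∀ x, p (-x) = p x) (n : ℕ) :
    2 * (n * survival p n 0) ≤ ∑ m ∈ Finset.range n, survival p m 0 := by
  have h1 : ∀ z, (n : ℝ≥0∞) * killedPow p n 0 z = ∑ k ∈ Finset.range n,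
      ∑' y, killedPow p (n - 1 - k) 0 y * freeUp p k y z := by
    intro z
    rw [← KernelMat.natCast_mul_apply, natCast_mul_killedPow, KernelMat.sum_apply]
    refine Finset.sum_congr rfl fun k _ => ?_
    rw [KernelMat.add_apply, KernelMat.mul_apply, KernelMat.mul_apply]
    have : ∀ y, freeDown p k 0 y = 0 := fun y => by
      simp only [freeDown]
      exact if_neg (by omega)
    simp [this]
  have h2 : ∀ k y, 2 * ∑' z, freeUp p k y z ≤ 1 := by
    intro k y
    refine le_trans (mul_le_mul_right (le_of_eq ?_) 2) (two_mul_tsum_stepPow_pos_le hp hs (k + 1))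
    refine ((add_left_injective (y + 1)).tsum_eq (f := fun z => freeUp p k y z) ?_).symm.trans ?_
    · intro z hz
      have h : y < z := by
        by_contra h
        exact hz (by simp [freeUp, h])
      exact ⟨z - (y + 1), by simp; omega⟩
    · refine tsum_congr fun d => ?_
      have h : y < d + (y + 1) := by omega
      simp only [freeUp, h, if_true]
      congr 1; push_cast; ring
  rw [survival, ← ENNReal.tsum_mul_left, tsum_congr h1,
    Summable.tsum_finsetSum fun _ _ => ENNReal.summable, Finset.mul_sum,
    ← Finset.sum_range_reflect (fun m => survival p m 0)]
  refine Finset.sum_le_sum fun k _ => ?_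
  rw [ENNReal.tsum_comm]
  simp only [ENNReal.tsum_mul_left]
  rw [← ENNReal.tsum_mul_left, survival]
  refine ENNReal.tsum_le_tsum fun y => ?_
  rw [mul_left_comm]
  exact mul_le_of_le_one_right' (h2 k y)

lemma sum_range_le_two_mul_sqrt {a : ℕ → ℝ} (h0 : a 0 ≤ 1)
    (h : ∀ n : ℕ, 2 * (n * a n) ≤ ∑ m ∈ Finset.range n, a m) (n : ℕ) :
    ∑ m ∈ Finset.range n, a m ≤ 2 * √n := by
  have key : ∀ n : ℕ, ∑ m ∈ Finset.range (n + 1), a m ≤ √(4 / 3 * (n + 3 / 4)) := by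
    intro n
    induction n with
    | zero =>
      rw [zero_add, Finset.sum_range_one]
      exact h0.trans (Real.le_sqrt_of_sq_le (by norm_num))
    | succ n ih =>
      rw [Finset.sum_range_succ]
      have hn : (0 : ℝ) < (n : ℝ) + 1 := by positivity
      have h1 := h (n + 1)
      push_cast at h1 ⊢
      set S := ∑ m ∈ Finset.range (n + 1), a m
      have h2 : a (n + 1) ≤ S / (2 * (n + 1)) := by
        rw [le_div_iff₀ (by positivity)]; linarith
      have h3 : S + a (n + 1) ≤ √(4 / 3 * (n + 3 / 4)) * (1 + 1 / (2 * (n + 1))) := by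
        calc S + a (n + 1) ≤ S + S / (2 * (n + 1)) := by linarith
          _ = S * (1 + 1 / (2 * (n + 1))) := by ring
          _ ≤ _ := by gcongr
      refine h3.trans (Real.le_sqrt_of_sq_le ?_)
      rw [mul_pow, Real.sq_sqrt (by positivity)]
      have : (n : ℝ) + 1 + 3 / 4 - (n + 3 / 4) * (1 + 1 / (2 * (n + 1))) ^ 2
          = (1 / 16) / (n + 1) ^ 2 := by
        field_simp; ring
      have h4 : (0 : ℝ) ≤ (1 / 16) / (n + 1) ^ 2 := by positivity
      linarith
  rcases n with _ | n
  · simp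
  · refine (key n).trans ?_
    rw [show (2 : ℝ) * √((n + 1 : ℕ) : ℝ) = √(4 * (n + 1 : ℕ)) by
      rw [Real.sqrt_mul (by norm_num)]; congr 1; rw [show (4 : ℝ) = 2 ^ 2 by norm_num]; simp]
    apply Real.sqrt_le_sqrt
    push_cast
    have : (0 : ℝ) ≤ n := Nat.cast_nonneg n
    linarith

lemma sum_survival_zero_le (hp : ∑' x, p x = 1) (hs : ∀ x, p (-x) = p x) (n : ℕ) :
    ∑ m ∈ Finset.range n, survival p m 0 ≤ ENNReal.ofReal (2 * √n) := by
  have hfin : ∀ m, survival p m 0 ≠ ∞ := fun m =>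
    ne_top_of_le_ne_top ENNReal.one_ne_top (survival_le_one hp m 0)
  have hfin' : ∀ n, ∑ m ∈ Finset.range n, survival p m 0 ≠ ∞ := fun n =>
    ENNReal.sum_ne_top.2 fun m _ => hfin m
  rw [ENNReal.le_ofReal_iff_toReal_le (hfin' n) (by positivity),
    ENNReal.toReal_sum fun m _ => hfin m]
  refine sum_range_le_two_mul_sqrt ?_ (fun n => ?_) n
  · simp [survival_zero]
  · have h := ENNReal.toReal_mono (hfin' n) (two_mul_natCast_mul_survival_zero_le hp hs n)
    rwa [ENNReal.toReal_sum fun m _ => hfin m, ENNReal.toReal_mul, ENNReal.toReal_mul,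
      ENNReal.toReal_natCast, ENNReal.toReal_ofNat] at h

lemma survival_succ_eq (p : ℤ → ℝ≥0∞) (n w : ℕ) :
    survival p n (w + 1) = (if 0 < w then survival p n w else 0)
      + ∑ m ∈ Finset.range (n + 1), killedPow p m (w + 1) 1 * survival p (n - m) 0 := by
  rw [survival, tsum_eq_zero_add' ENNReal.summable, killedPow_zero_right p n (Nat.succ_pos w),
    zero_add, tsum_congr fun z => killedPow_succ_succ p n w z, ENNReal.tsum_add]
  congr 1
  · split_ifs
    · rfl
    · simp
  · rw [Summable.tsum_finsetSum fun _ _ => ENNReal.summable]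
    simp only [ENNReal.tsum_mul_left, survival]

lemma ENNReal.sum_range_sum_range_mul_le (f g : ℕ → ℝ≥0∞) (N : ℕ) :
    ∑ n ∈ Finset.range N, ∑ m ∈ Finset.range (n + 1), f m * g (n - m)
      ≤ (∑' n, f n) * ∑ n ∈ Finset.range N, g n := by
  have h1 : ∑ n ∈ Finset.range N, ∑ m ∈ Finset.range (n + 1), f m * g (n - m)
      ≤ ∑' n, ∑ m ∈ Finset.range (n + 1), f m * (if n - m < N then g (n - m) else 0) := by
    refine le_trans (le_of_eq ?_) (ENNReal.sum_le_tsum (Finset.range N))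
    refine Finset.sum_congr rfl fun n hn => Finset.sum_congr rfl fun m _ => ?_
    have := Finset.mem_range.1 hn
    rw [if_pos (by omega)]
  refine h1.trans (le_of_eq ?_)
  rw [ENNReal.tsum_sum_range_mul f fun k => if k < N then g k else 0]
  congr 1
  rw [tsum_eq_sum (s := Finset.range N) fun k hk => if_neg (by simpa using hk)]
  exact Finset.sum_congr rfl fun k hk => if_pos (Finset.mem_range.1 hk)

lemma sum_survival_le (hs : ∀ x, p (-x) = p x) (N w : ℕ) (hw : 0 < w) :
    ∑ n ∈ Finset.range N, survival p n w
      ≤ greenFun p 1 1 * renewal p w * ∑ n ∈ Finset.range N, survival p n 0 := by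
  have key : ∀ w, ∑ n ∈ Finset.range N, survival p n (w + 1)
      ≤ (if 0 < w then ∑ n ∈ Finset.range N, survival p n w else 0)
        + greenFun p 1 1 * greenFun p 0 w * ∑ n ∈ Finset.range N, survival p n 0 := by
    intro w
    rw [Finset.sum_congr rfl fun n _ => survival_succ_eq p n w, Finset.sum_add_distrib]
    refine add_le_add (le_of_eq ?_) ?_
    · split_ifs <;> simp
    · refine (ENNReal.sum_range_sum_range_mul_le (fun m => killedPow p m (w + 1) 1)
        (fun m => survival p m 0) N).trans (le_of_eq ?_)
      congr 1
      exact greenFun_succ_one hs w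
  induction w with
  | zero => exact absurd hw (lt_irrefl 0)
  | succ w ih =>
    refine (key w).trans ?_
    rw [renewal_succ, mul_add, add_mul]
    refine add_le_add ?_ le_rfl
    split_ifs with h
    · exact ih h
    · exact zero_le

/-- A walk started from `0` that jumps to `y` and then makes an excursion above `y` back to
`y` is a path that stays positive. -/
lemma mul_greenFun_one_one_le (p : ℤ → ℝ≥0∞) (y : ℕ) (hy : 0 < y) :
    p y * greenFun p 1 1 ≤ greenFun p 0 y := by
  have hmono : ∀ n y, killedPow p n 1 1 ≤ killedPow p n (y + 1) (y + 1) := by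
    intro n y
    induction y with
    | zero => simp
    | succ y ih =>
      rw [killedPow_succ_succ p n (y + 1) (y + 1), if_pos (Nat.succ_pos y)]
      exact ih.trans le_self_add
  rw [greenFun, greenFun, ← ENNReal.tsum_mul_left,
    tsum_eq_zero_add' (f := fun n => killedPow p n 0 y) ENNReal.summable]
  refine le_trans (ENNReal.tsum_le_tsum fun n => ?_) le_add_self
  have h1 : killedPow p (n + 1) 0 y = ∑' x, killedStep p 0 x * killedPow p n x y := by
    rw [killedPow, pow_succ', KernelMat.mul_apply]; rfl
  rw [h1]
  refine le_trans ?_ (ENNReal.le_tsum y)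
  obtain ⟨y, rfl⟩ := Nat.exists_eq_succ_of_ne_zero hy.ne'
  refine mul_le_mul' ?_ (hmono n y)
  simp [killedStep]

lemma greenFun_one_one_ne_top (hU : ∀ z : ℕ, renewal p z ≠ ∞) {y : ℕ} (hy : 0 < y)
    (hpy : p y ≠ 0) : greenFun p 1 1 ≠ ∞ := by
  intro h
  have h1 := mul_greenFun_one_one_le p y hy
  rw [h, ENNReal.mul_top hpy, top_le_iff] at h1
  have h2 := hU (y + 1)
  rw [renewal_succ, h1] at h2
  simp at h2

lemma survival_toReal_le (hp : ∑' x, p x = 1) (hs : ∀ x, p (-x) = p x)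
    (hc : greenFun p 1 1 ≠ ∞) (hU : ∀ z : ℕ, renewal p z ≠ ∞) (n w : ℕ) (hw : 0 < w) :
    (survival p n w).toReal
      ≤ 2 * (greenFun p 1 1).toReal * (renewal p w).toReal / √(n + 1) := by
  have h1 : ((n + 1 : ℕ) : ℝ≥0∞) * survival p n w
      ≤ greenFun p 1 1 * renewal p w * ENNReal.ofReal (2 * √(n + 1 : ℕ)) := by
    refine le_trans ?_ ((sum_survival_le hs (n + 1) w hw).trans
      (mul_le_mul_right (sum_survival_zero_le hp hs (n + 1)) _))
    rw [← nsmul_eq_mul, ← Finset.card_range (n + 1), ← Finset.sum_const, Finset.card_range]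
    exact Finset.sum_le_sum fun m hm =>
      survival_antitone hp w (Nat.lt_succ_iff.1 (Finset.mem_range.1 hm))
  have h2 := ENNReal.toReal_mono
    (ENNReal.mul_ne_top (ENNReal.mul_ne_top hc (hU w)) ENNReal.ofReal_ne_top) h1
  simp only [ENNReal.toReal_mul, ENNReal.toReal_natCast] at h2
  rw [ENNReal.toReal_ofReal (by positivity)] at h2
  have h3 : (0 : ℝ) < √((n : ℝ) + 1) := by positivity
  rw [le_div_iff₀ h3]
  have h4 : ((n + 1 : ℕ) : ℝ) = √((n : ℝ) + 1) * √((n : ℝ) + 1) := by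
    rw [Real.mul_self_sqrt (by positivity)]; push_cast; rfl
  have h5 : √((n : ℝ) + 1) * ((survival p n w).toReal * √((n : ℝ) + 1))
      ≤ √((n : ℝ) + 1) * (2 * (greenFun p 1 1).toReal * (renewal p w).toReal) := by
    calc _ = ((n + 1 : ℕ) : ℝ) * (survival p n w).toReal := by rw [h4]; ring
      _ ≤ _ := h2
      _ = _ := by push_cast; ring
  exact le_of_mul_le_mul_left h5 h3

/-- A path of length `m + k + l` is alive at time `m`, and so is, at time `l`, its reversal. -/
lemma killedPow_add_add_le (hs : ∀ x, p (-x) = p x) {s : ℝ≥0∞} (m k l : ℕ)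
    (hk : ∀ x, stepPow p k x ≤ s) {w z : ℕ} (hw : 0 < w) (hz : 0 < z) :
    killedPow p (m + k + l) w z ≤ survival p m w * s * survival p l z := by
  have hmid : ∀ y, killedPow p (m + k) w y ≤ survival p m w * s := by
    intro y
    rw [killedPow_add_apply, survival, ← ENNReal.tsum_mul_right]
    exact ENNReal.tsum_le_tsum fun x =>
      mul_le_mul' le_rfl ((killedPow_le_stepPow p k x y).trans (hk _))
  have hdef : survival p l z = ∑' y, killedPow p l z y := rfl
  rw [killedPow_add_apply, hdef, ← ENNReal.tsum_mul_left]
  refine ENNReal.tsum_le_tsum fun y => ?_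
  rcases Nat.eq_zero_or_pos y with rfl | hy
  · rw [killedPow_zero_right p _ hw, zero_mul]; exact zero_le
  · rw [killedPow_symm hs l hy hz]
    exact mul_le_mul' (hmid y) le_rfl

theorem killedPow_toReal_le (hp : ∑' x, p x = 1) (hs : ∀ x, p (-x) = p x)
    (hc : greenFun p 1 1 ≠ ∞) (hU : ∀ z : ℕ, renewal p z ≠ ∞) {D : ℝ}
    (hD : ∀ n x, (stepPow p n x).toReal * √n ≤ D) :
    ∃ B : ℝ, 0 ≤ B ∧ ∀ n w z : ℕ, 0 < n → 0 < w → 0 < z →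
      (killedPow p n w z).toReal
        ≤ B * ((renewal p w).toReal * (renewal p z).toReal) / (n * √n) := by
  have hD0 : 0 ≤ D := le_trans (by positivity) (hD 0 0)
  set c := (greenFun p 1 1).toReal with hcdef
  refine ⟨(2 * c) * (2 * c) * D * (3 * √3), by positivity, fun n w z hn hw hz => ?_⟩
  obtain ⟨m, k, hmk, hm, hk⟩ : ∃ m k : ℕ, m + k + m = n ∧ n ≤ 3 * (m + 1) ∧ n ≤ 3 * k :=
    ⟨n / 3, n - 2 * (n / 3), by omega, by omega, by omega⟩
  have hk0 : 0 < k := by omega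
  have hfq : ∀ x, stepPow p k x ≠ ∞ := fun x =>
    ne_top_of_le_ne_top ENNReal.one_ne_top (stepPow_le_one hp k x)
  have hfs : ∀ w, survival p m w ≠ ∞ := fun w =>
    ne_top_of_le_ne_top ENNReal.one_ne_top (survival_le_one hp m w)
  have h1 := killedPow_add_add_le hs (s := ENNReal.ofReal (D / √k)) m k m (fun x => by
    rw [ENNReal.le_ofReal_iff_toReal_le (hfq x) (by positivity), le_div_iff₀ (by positivity)]
    exact hD k x) hw hz
  rw [hmk] at h1
  have h2 := ENNReal.toReal_mono
    (ENNReal.mul_ne_top (ENNReal.mul_ne_top (hfs w) ENNReal.ofReal_ne_top) (hfs z)) h1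
  rw [ENNReal.toReal_mul, ENNReal.toReal_mul, ENNReal.toReal_ofReal (by positivity)] at h2
  have hn' : (0 : ℝ) < n := by exact_mod_cast hn
  have hr : 0 < √((n : ℝ) / 3) := by positivity
  have hkr : √((n : ℝ) / 3) ≤ √k := by
    apply Real.sqrt_le_sqrt
    rw [div_le_iff₀ (by norm_num)]; exact_mod_cast (by omega : n ≤ k * 3)
  have hmr : √((n : ℝ) / 3) ≤ √((m : ℝ) + 1) := by
    apply Real.sqrt_le_sqrt
    rw [div_le_iff₀ (by norm_num)]; exact_mod_cast (by omega : n ≤ (m + 1) * 3)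
  have hsv : ∀ w, 0 < w → (survival p m w).toReal
      ≤ 2 * c * (renewal p w).toReal / √((n : ℝ) / 3) := fun w hw =>
    (survival_toReal_le hp hs hc hU m w hw).trans (by gcongr)
  calc _ ≤ _ := h2
    _ ≤ (2 * c * (renewal p w).toReal / √((n : ℝ) / 3)) * (D / √((n : ℝ) / 3))
        * (2 * c * (renewal p z).toReal / √((n : ℝ) / 3)) := by
        gcongr
        · exact hsv w hw
        · exact hsv z hz
    _ = (2 * c) * (2 * c) * D * ((renewal p w).toReal * (renewal p z).toReal)
        / (√((n : ℝ) / 3) * √((n : ℝ) / 3) * √((n : ℝ) / 3)) := by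
        field_simp
    _ = _ := by
        rw [Real.mul_self_sqrt (by positivity), Real.sqrt_div (by positivity)]
        have h3 : √(3 : ℝ) ≠ 0 := by positivity
        have h4 : √(n : ℝ) ≠ 0 := by positivity
        field_simp

end Survival

/-! ### From paths to transition matrices -/

section Paths

lemma walk_succ {Ω : Type*} (ξ : ℕ → Ω → ℤ) (w : ℤ) (n : ℕ) (ω : Ω) :
    walk ξ w (n + 1) ω = walk ξ w n ω + ξ n ω := by
  simp only [walk, Finset.sum_range_succ, add_assoc]

lemma walk_zero {Ω : Type*} (ξ : ℕ → Ω → ℤ) (w : ℤ) (ω : Ω) : walk ξ w 0 ω = w := by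
  simp [walk]

/-- The event in the definition of `posTransProb`. -/
def stayPos {Ω : Type*} (ξ : ℕ → Ω → ℤ) (n : ℕ) (w z : ℤ) : Set Ω :=
  {ω | walk ξ w n ω = z ∧ ∀ k : ℕ, 1 ≤ k → k ≤ n → 0 < walk ξ w k ω}

/-- The event that the walk that uses the steps from index `i` on has a strict ladder
time at `m`, with height `x`. -/
def ladderAt {Ω : Type*} (ξ : ℕ → Ω → ℤ) (i m : ℕ) (x : ℤ) : Set Ω :=
  {ω | ∑ k ∈ Finset.range m, ξ (i + k) ω = x ∧
    ∀ l < m, ∑ k ∈ Finset.range l, ξ (i + k) ω < x}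

lemma ladderAt_eq_empty {Ω : Type*} (ξ : ℕ → Ω → ℤ) (i m : ℕ) {x : ℤ} (hx : x < 0) :
    ladderAt ξ i m x = ∅ := by
  ext ω
  simp only [ladderAt, Set.mem_ofPred_eq, Set.mem_empty_iff_false, iff_false]
  rintro ⟨h1, h2⟩
  rcases Nat.eq_zero_or_pos m with rfl | hm
  · simp at h1; omega
  · have := h2 0 hm
    simp at this; omega

variable {Ω : Type*} [MeasurableSpace Ω] {P : Measure Ω} {ξ : ℕ → Ω → ℤ}

/-- The step law of the walk, with values in `[0, ∞]`. -/
noncomputable def stepLaw (P : Measure Ω) (ξ : ℕ → Ω → ℤ) (a : ℤ) : ℝ≥0∞ := P {ω | ξ 0 ω = a}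

lemma measure_eq_tsum_inter_fiber (P : Measure Ω) {f : Ω → ℤ} (hf : Measurable f) {E : Set Ω}
    (hE : MeasurableSet E) : P E = ∑' y, P (E ∩ {ω | f ω = y}) := by
  rw [← measure_iUnion]
  · congr 1; ext ω; simp
  · intro a b hab
    refine Set.disjoint_left.2 fun ω h1 h2 => hab ?_
    exact h1.2.symm.trans h2.2
  · exact fun y => hE.inter (hf (measurableSet_singleton y))

lemma tsum_stepLaw [IsProbabilityMeasure P] (hmeas : ∀ k, Measurable (ξ k)) :
    ∑' a, stepLaw P ξ a = 1 := by
  have h := measure_eq_tsum_inter_fiber P (hmeas 0) MeasurableSet.univ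
  simpa [stepLaw] using h.symm

/-- The information carried by the steps with index in `S`. -/
abbrev stepAlgebra (ξ : ℕ → Ω → ℤ) (S : Set ℕ) : MeasurableSpace Ω :=
  ⨆ k ∈ S, MeasurableSpace.comap (ξ k) ⊤

lemma stepAlgebra_le (hmeas : ∀ k, Measurable (ξ k)) (S : Set ℕ) :
    stepAlgebra ξ S ≤ ‹MeasurableSpace Ω› :=
  iSup₂_le fun k _ => (hmeas k).comap_le

lemma measurable_step {Ω : Type*} {ξ : ℕ → Ω → ℤ} (S : Set ℕ) {k : ℕ} (hk : k ∈ S) :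
    Measurable[stepAlgebra ξ S] (ξ k) := by
  have h : MeasurableSpace.comap (ξ k) ⊤ ≤ stepAlgebra ξ S :=
    le_iSup₂ (f := fun k (_ : k ∈ S) => MeasurableSpace.comap (ξ k) ⊤) k hk
  exact (comap_measurable (m := ⊤) (ξ k)).mono h le_rfl

lemma measurable_sum_step {Ω : Type*} {ξ : ℕ → Ω → ℤ} (S : Set ℕ) (c : ℤ) {F : Finset ℕ} {e : ℕ → ℕ}
    (hF : ∀ k ∈ F, e k ∈ S) :
    Measurable[stepAlgebra ξ S] fun ω => c + ∑ k ∈ F, ξ (e k) ω := by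
  refine Measurable.const_add ?_ c
  exact Finset.measurable_fun_sum F fun k hk => measurable_step S (hF k hk)

lemma measure_inter_step (hmeas : ∀ k, Measurable (ξ k)) (hindep : iIndepFun ξ P)
    (hident : ∀ k, IdentDistrib (ξ k) (ξ 0) P P) {S : Set ℕ} {j : ℕ} (hj : j ∉ S) {E : Set Ω}
    (hE : MeasurableSet[stepAlgebra ξ S] E) (a : ℤ) :
    P (E ∩ {ω | ξ j ω = a}) = P E * stepLaw P ξ a := by
  have h := indep_iSup_of_disjoint (fun k => (hmeas k).comap_le) hindep
    (Set.disjoint_singleton_right.2 hj)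
  have h1 := (Indep_iff _ _ _).1 h E {ω | ξ j ω = a} hE
    (measurable_step {j} (Set.mem_singleton j) (measurableSet_singleton a))
  rw [h1]
  congr 1
  exact (hident j).measure_mem_eq (measurableSet_singleton a)

lemma measurable_walk_stepAlgebra {Ω : Type*} (ξ : ℕ → Ω → ℤ) (w : ℤ) {k n : ℕ} (hk : k ≤ n) :
    Measurable[stepAlgebra ξ (Set.Iio n)] (walk ξ w k) :=
  measurable_sum_step (Set.Iio n) w (e := id) fun _ hi =>
    Set.mem_Iio.2 ((Finset.mem_range.1 hi).trans_le hk)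

lemma measurable_walk (hmeas : ∀ k, Measurable (ξ k)) (w : ℤ) (n : ℕ) : Measurable (walk ξ w n) :=
  (measurable_walk_stepAlgebra ξ w le_rfl).mono (stepAlgebra_le hmeas _) le_rfl

lemma measure_walk_eq [IsProbabilityMeasure P] (hmeas : ∀ k, Measurable (ξ k))
    (hindep : iIndepFun ξ P) (hident : ∀ k, IdentDistrib (ξ k) (ξ 0) P P) (n : ℕ) (w z : ℤ) :
    P {ω | walk ξ w n ω = z} = stepPow (stepLaw P ξ) n (z - w) := by
  induction n generalizing z with
  | zero =>
    change _ = (Pi.single 0 1 : ℤ → ℝ≥0∞) _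
    simp only [walk_zero, Pi.single_apply, sub_eq_zero, eq_comm (a := z)]
    split_ifs with h <;> simp [h]
  | succ n ih =>
    rw [stepPow_succ, measure_eq_tsum_inter_fiber P (measurable_walk hmeas w n)
      (E := {ω | walk ξ w (n + 1) ω = z})
      (measurable_walk hmeas w (n + 1) (measurableSet_singleton z)),
      ← tsum_int_sub_right (fun y => stepPow (stepLaw P ξ) n y * stepLaw P ξ (z - w - y)) w]
    refine tsum_congr fun y => ?_
    rw [← ih, show z - w - (y - w) = z - y by ring,
      ← measure_inter_step hmeas hindep hident (S := Set.Iio n) (j := n) (by simp)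
        (E := {ω | walk ξ w n ω = y})
        (measurable_walk_stepAlgebra ξ w (le_refl n) (measurableSet_singleton y))]
    congr 1
    ext ω
    simp only [Set.mem_inter_iff, Set.mem_ofPred_eq,
      walk_succ]
    constructor <;> rintro ⟨h1, h2⟩ <;> constructor <;> omega

lemma measurableSet_stayPos {Ω : Type*} (ξ : ℕ → Ω → ℤ) (n : ℕ) (w z : ℤ) :
    MeasurableSet[stepAlgebra ξ (Set.Iio n)] (stayPos ξ n w z) := by
  refine @MeasurableSet.inter _ (stepAlgebra ξ (Set.Iio n)) _ _
    (measurable_walk_stepAlgebra ξ w le_rfl (measurableSet_singleton z)) ?_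
  have : {ω | ∀ k : ℕ, 1 ≤ k → k ≤ n → 0 < walk ξ w k ω}
      = ⋂ k : ℕ, ⋂ _ : 1 ≤ k, ⋂ _ : k ≤ n, {ω | 0 < walk ξ w k ω} := by
    ext ω; simp
  change MeasurableSet[stepAlgebra ξ (Set.Iio n)] {ω | ∀ k : ℕ, 1 ≤ k → k ≤ n → 0 < walk ξ w k ω}
  rw [this]
  refine @MeasurableSet.iInter _ _ (stepAlgebra ξ (Set.Iio n)) _ _ fun k =>
    @MeasurableSet.iInter _ _ (stepAlgebra ξ (Set.Iio n)) _ _ fun _ =>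
    @MeasurableSet.iInter _ _ (stepAlgebra ξ (Set.Iio n)) _ _ fun hk => ?_
  exact measurable_walk_stepAlgebra ξ w hk measurableSet_Ioi

lemma measure_stayPos [IsProbabilityMeasure P] (hmeas : ∀ k, Measurable (ξ k))
    (hindep : iIndepFun ξ P) (hident : ∀ k, IdentDistrib (ξ k) (ξ 0) P P) (n w z : ℕ) :
    P (stayPos ξ n w z) = killedPow (stepLaw P ξ) n w z := by
  induction n generalizing z with
  | zero =>
    rw [killedPow_zero_apply]
    have : stayPos ξ 0 (w : ℤ) z = {_ω | w = z} := by
      ext ω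
      simp only [stayPos, walk_zero, Set.mem_ofPred_eq, Nat.cast_inj]
      exact ⟨fun h => h.1, fun h => ⟨h, fun k h1 h2 => by omega⟩⟩
    rw [this]
    split_ifs with h <;> simp [h]
  | succ n ih =>
    rw [killedPow_succ_apply]
    rcases Nat.eq_zero_or_pos z with rfl | hz
    · have : stayPos ξ (n + 1) (w : ℤ) ((0 : ℕ) : ℤ) = ∅ := by
        ext ω
        simp only [stayPos, Set.mem_ofPred_eq, Set.mem_empty_iff_false, iff_false]
        rintro ⟨h1, h2⟩
        have := h2 (n + 1) (by omega) le_rfl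
        rw [h1] at this
        simp at this
      rw [this, measure_empty]
      simp [killedStep_zero_right]
    · rw [measure_eq_tsum_inter_fiber P (measurable_walk hmeas w n)
        (stepAlgebra_le hmeas _ _ (measurableSet_stayPos ξ (n + 1) w z))]
      have hset : ∀ y : ℤ, stayPos ξ (n + 1) (w : ℤ) z ∩ {ω | walk ξ w n ω = y}
          = stayPos ξ n w y ∩ {ω | ξ n ω = z - y} := by
        intro y
        ext ω
        simp only [stayPos, Set.mem_inter_iff, Set.mem_ofPred_eq, walk_succ]
        constructor
        · rintro ⟨⟨h1, h2⟩, h3⟩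
          exact ⟨⟨h3, fun k hk hk' => h2 k hk (by omega)⟩, by omega⟩
        · rintro ⟨⟨h1, h2⟩, h3⟩
          refine ⟨⟨by omega, fun k hk hk' => ?_⟩, h1⟩
          rcases Nat.lt_or_ge n k with h | h
          · obtain rfl : k = n + 1 := by omega
            rw [walk_succ]; omega
          · exact h2 k hk h
      have hmul : ∀ y : ℤ, P (stayPos ξ (n + 1) (w : ℤ) z ∩ {ω | walk ξ w n ω = y})
          = P (stayPos ξ n w y) * stepLaw P ξ (z - y) := fun y => by
        rw [hset, measure_inter_step hmeas hindep hident (S := Set.Iio n) (by simp)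
          (measurableSet_stayPos ξ n w y)]
      rw [tsum_congr hmul, tsum_int_eq_tsum_nat]
      · refine tsum_congr fun y => ?_
        rw [ih]
        simp [killedStep, hz]
      · intro y hy
        have : stayPos ξ n (w : ℤ) y = ∅ := by
          ext ω
          simp only [stayPos, Set.mem_ofPred_eq, Set.mem_empty_iff_false, iff_false]
          rintro ⟨h1, h2⟩
          rcases Nat.eq_zero_or_pos n with rfl | hn
          · rw [walk_zero] at h1; omega
          · have := h2 n hn le_rfl
            omega
        simp [this]

lemma measurable_sum_range_add {Ω : Type*} (ξ : ℕ → Ω → ℤ) (i m : ℕ) :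
    Measurable[stepAlgebra ξ (Set.Ici i)] fun ω => ∑ k ∈ Finset.range m, ξ (i + k) ω := by
  simpa using measurable_sum_step (ξ := ξ) (Set.Ici i) 0 (F := Finset.range m) (e := fun k => i + k)
    fun _ _ => Set.mem_Ici.2 (Nat.le_add_right _ _)

lemma measurableSet_ladderAt {Ω : Type*} (ξ : ℕ → Ω → ℤ) (i m : ℕ) (x : ℤ) :
    MeasurableSet[stepAlgebra ξ (Set.Ici i)] (ladderAt ξ i m x) := by
  refine @MeasurableSet.inter _ (stepAlgebra ξ (Set.Ici i)) _ _
    (measurable_sum_range_add ξ i m (measurableSet_singleton x)) ?_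
  have : {ω | ∀ l < m, ∑ k ∈ Finset.range l, ξ (i + k) ω < x}
      = ⋂ l : ℕ, ⋂ _ : l < m, {ω | ∑ k ∈ Finset.range l, ξ (i + k) ω < x} := by
    ext ω; simp
  change MeasurableSet[stepAlgebra ξ (Set.Ici i)]
    {ω | ∀ l < m, ∑ k ∈ Finset.range l, ξ (i + k) ω < x}
  rw [this]
  refine @MeasurableSet.iInter _ _ (stepAlgebra ξ (Set.Ici i)) _ _ fun l =>
    @MeasurableSet.iInter _ _ (stepAlgebra ξ (Set.Ici i)) _ _ fun _ => ?_
  exact measurable_sum_range_add ξ i l measurableSet_Iio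

/-- A ladder time of height `x` and a walk from `0` to `x` that stays positive have the same
probability: conditioning the former on the first step and the latter on the last step
gives the same recursion. -/
lemma measure_ladderAt [IsProbabilityMeasure P] (hmeas : ∀ k, Measurable (ξ k))
    (hindep : iIndepFun ξ P) (hident : ∀ k, IdentDistrib (ξ k) (ξ 0) P P) (i m x : ℕ) :
    P (ladderAt ξ i m x) = killedPow (stepLaw P ξ) m 0 x := by
  induction m generalizing i x with
  | zero =>
    rw [killedPow_zero_apply]
    have : ladderAt ξ i 0 (x : ℤ) = {_ω | 0 = x} := by
      ext ω
      simp only [ladderAt, Set.mem_ofPred_eq, Finset.range_zero, Finset.sum_empty, Nat.not_lt_zero]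
      simp; omega
    rw [this]
    split_ifs with h <;> simp [h]
  | succ m ih =>
    rw [killedPow_succ_apply]
    rcases Nat.eq_zero_or_pos x with rfl | hx
    · have : ladderAt ξ i (m + 1) ((0 : ℕ) : ℤ) = ∅ := by
        ext ω
        simp only [ladderAt, Set.mem_ofPred_eq, Set.mem_empty_iff_false, iff_false]
        rintro ⟨h1, h2⟩
        simpa using h2 0 (Nat.succ_pos m)
      rw [this, measure_empty]
      simp [killedStep_zero_right]
    · have hsucc : ∀ (l : ℕ) (ω : Ω), ∑ k ∈ Finset.range (l + 1), ξ (i + k) ω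
          = ∑ k ∈ Finset.range l, ξ (i + 1 + k) ω + ξ i ω := by
        intro l ω
        rw [Finset.sum_range_succ']
        simp only [add_zero, add_assoc, add_comm 1]
      rw [measure_eq_tsum_inter_fiber P
        ((measurable_sum_range_add ξ (i + 1) m).mono (stepAlgebra_le hmeas _) le_rfl)
        (stepAlgebra_le hmeas _ _ (measurableSet_ladderAt ξ i (m + 1) x))]
      have hset : ∀ y : ℤ, ladderAt ξ i (m + 1) (x : ℤ)
            ∩ {ω | ∑ k ∈ Finset.range m, ξ (i + 1 + k) ω = y}
          = ladderAt ξ (i + 1) m y ∩ {ω | ξ i ω = x - y} := by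
        intro y
        ext ω
        simp only [ladderAt, Set.mem_inter_iff, Set.mem_ofPred_eq, hsucc]
        constructor
        · rintro ⟨⟨h1, h2⟩, h3⟩
          refine ⟨⟨h3, fun l hl => ?_⟩, by omega⟩
          have := h2 (l + 1) (by omega)
          rw [hsucc] at this
          omega
        · rintro ⟨⟨h1, h2⟩, h3⟩
          refine ⟨⟨by omega, fun l hl => ?_⟩, h1⟩
          rcases l with _ | l
          · simpa using hx
          · have := h2 l (by omega)
            rw [hsucc]; omega
      have hmul : ∀ y : ℤ, P (ladderAt ξ i (m + 1) (x : ℤ)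
            ∩ {ω | ∑ k ∈ Finset.range m, ξ (i + 1 + k) ω = y})
          = P (ladderAt ξ (i + 1) m y) * stepLaw P ξ (x - y) := fun y => by
        rw [hset, measure_inter_step hmeas hindep hident (S := Set.Ici (i + 1)) (by simp)
          (measurableSet_ladderAt ξ (i + 1) m y)]
      rw [tsum_congr hmul, tsum_int_eq_tsum_nat]
      · refine tsum_congr fun y => ?_
        rw [ih]
        simp [killedStep, hx]
      · intro y hy
        simp [ladderAt_eq_empty ξ (i + 1) m hy]

lemma lintegral_ladderCount [IsProbabilityMeasure P] (hmeas : ∀ k, Measurable (ξ k))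
    (hindep : iIndepFun ξ P) (hident : ∀ k, IdentDistrib (ξ k) (ξ 0) P P) (z : ℕ) :
    ∫⁻ ω, (ladderCount (fun m => walk ξ 0 m ω) z : ℝ≥0∞) ∂P = renewal (stepLaw P ξ) z := by
  have hev : ∀ m, {ω | walk ξ 0 m ω < z ∧ IsStrictLadderTime (fun m => walk ξ 0 m ω) m}
      = ⋃ x ∈ Finset.range z, ladderAt ξ 0 m (x : ℤ) := by
    intro m
    ext ω
    simp only [IsStrictLadderTime, walk, ladderAt, zero_add, Set.mem_ofPred_eq, Set.mem_iUnion,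
      Finset.mem_range, exists_prop]
    constructor
    · rintro ⟨h1, h2⟩
      have h0 : 0 ≤ ∑ k ∈ Finset.range m, ξ k ω := by
        rcases Nat.eq_zero_or_pos m with rfl | hm
        · simp
        · simpa using (h2 0 hm).le
      exact ⟨(∑ k ∈ Finset.range m, ξ k ω).toNat, by omega, by omega, fun l hl => by
        have := h2 l hl; omega⟩
    · rintro ⟨x, hx, h1, h2⟩
      exact ⟨by omega, fun l hl => by have := h2 l hl; omega⟩
  have hmE : ∀ m (x : ℤ), MeasurableSet (ladderAt ξ 0 m x) := fun m x =>
    stepAlgebra_le hmeas _ _ (measurableSet_ladderAt ξ 0 m x)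
  have hcount : ∀ ω, (ladderCount (fun m => walk ξ 0 m ω) z : ℝ≥0∞)
      = ∑' m, (⋃ x ∈ Finset.range z, ladderAt ξ 0 m (x : ℤ)).indicator 1 ω := by
    intro ω
    rw [ladderCount, ← ENNReal.tsum_set_one, tsum_subtype _ fun _ => (1 : ℝ≥0∞)]
    refine tsum_congr fun m => ?_
    rw [← hev]
    rfl
  have hmU : ∀ m, MeasurableSet (⋃ x ∈ Finset.range z, ladderAt ξ 0 m (x : ℤ)) := fun m =>
    Finset.measurableSet_biUnion _ fun x _ => hmE m x
  simp only [hcount]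
  rw [lintegral_tsum fun m => (measurable_one.indicator (hmU m)).aemeasurable]
  simp only [renewal, greenFun]
  rw [← Summable.tsum_finsetSum fun _ _ => ENNReal.summable]
  refine tsum_congr fun m => ?_
  rw [lintegral_indicator_one (hmU m),
    measure_biUnion_finset]
  · exact Finset.sum_congr rfl fun x _ => measure_ladderAt hmeas hindep hident 0 m x
  · intro a _ b _ hab
    refine Set.disjoint_left.2 fun ω h1 h2 => hab ?_
    have := h1.1.symm.trans h2.1
    exact_mod_cast this
  · exact fun x _ => hmE m x

/-- The heights of the ladder times are distinct and nonnegative. -/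
lemma ladderCount_le (x : ℕ → ℤ) (hx : x 0 = 0) (z : ℕ) : ladderCount x z ≤ z := by
  have h : ladderCount x z ≤ (Finset.Ico (0 : ℤ) z : Set ℤ).encard := by
    refine Set.encard_le_encard_of_injOn (f := x) ?_ ?_
    · rintro m ⟨h1, h2⟩
      rw [Finset.mem_coe, Finset.mem_Ico]
      refine ⟨?_, h1⟩
      rcases Nat.eq_zero_or_pos m with rfl | hm
      · exact hx.ge
      · exact hx ▸ (h2 0 hm).le
    · rintro m ⟨_, h2⟩ n ⟨_, h4⟩ hmn
      rcases lt_trichotomy m n with h | h | h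
      · exact absurd (h4 m h) (by omega)
      · exact h
      · exact absurd (h2 n h) (by omega)
  rwa [Set.encard_coe_eq_coe_finsetCard, Int.card_Ico, sub_zero, Int.toNat_natCast] at h

lemma renewal_stepLaw_le [IsProbabilityMeasure P] (hmeas : ∀ k, Measurable (ξ k))
    (hindep : iIndepFun ξ P) (hident : ∀ k, IdentDistrib (ξ k) (ξ 0) P P) (z : ℕ) :
    renewal (stepLaw P ξ) z ≤ z := by
  rw [← lintegral_ladderCount hmeas hindep hident]
  calc _ ≤ ∫⁻ _, (z : ℝ≥0∞) ∂P := lintegral_mono fun ω => by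
        have := ladderCount_le (fun m => walk ξ 0 m ω) (walk_zero ξ 0 ω) z
        have h : ((ladderCount (fun m => walk ξ 0 m ω) z : ℕ∞) : ℝ≥0∞) ≤ ((z : ℕ∞) : ℝ≥0∞) :=
          ENat.toENNReal_mono this
        simpa using h
    _ = z := by simp

end Paths

lemma one_le_greenFun_zero_zero (p : ℤ → ℝ≥0∞) : 1 ≤ greenFun p 0 0 := by
  refine le_trans (le_of_eq ?_) (ENNReal.le_tsum 0)
  simp [killedPow_zero_apply]

lemma one_le_renewal (p : ℤ → ℝ≥0∞) {z : ℕ} (hz : 0 < z) : 1 ≤ renewal p z :=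
  (one_le_greenFun_zero_zero p).trans
    (Finset.single_le_sum (f := fun x => greenFun p 0 x) (fun _ _ => zero_le)
      (Finset.mem_range.2 hz))

/-! ### The characteristic function of a step -/

section CharFun

variable {Ω : Type*} [MeasurableSpace Ω] {P : Measure Ω} {ξ : ℕ → Ω → ℤ}

/-- The characteristic function of a step; it is real by symmetry, so that its
real part carries all the information. -/
noncomputable def stepChar (P : Measure Ω) (ξ : ℕ → Ω → ℤ) (θ : ℝ) : ℝ :=
  (charFun (P.map fun ω => (ξ 0 ω : ℝ)) θ).re

lemma identDistrib_neg_step [IsProbabilityMeasure P] (hmeas : ∀ k, Measurable (ξ k))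
    (hsymm : ∀ a : ℤ, P.real {ω | ξ 0 ω = a} = P.real {ω | ξ 0 ω = -a}) :
    IdentDistrib (ξ 0) (fun ω => -ξ 0 ω) P P where
  aemeasurable_fst := (hmeas 0).aemeasurable
  aemeasurable_snd := (hmeas 0).neg.aemeasurable
  map_eq := by
    refine Measure.ext_of_singleton fun a => ?_
    rw [Measure.map_apply (hmeas 0) (measurableSet_singleton a),
      Measure.map_apply (f := fun ω => -ξ 0 ω) (hmeas 0).neg (measurableSet_singleton a)]
    have h := hsymm a
    rw [measureReal_def, measureReal_def, ENNReal.toReal_eq_toReal_iff' (measure_ne_top _ _)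
      (measure_ne_top _ _)] at h
    refine h.trans ?_
    congr 1
    ext ω
    simp only [Set.mem_ofPred_eq, Set.mem_preimage, Set.mem_singleton_iff]
    omega

lemma measurable_castStep (hmeas : ∀ k, Measurable (ξ k)) (k : ℕ) :
    Measurable fun ω => (ξ k ω : ℝ) :=
  (measurable_from_top (f := fun a : ℤ => (a : ℝ))).comp (hmeas k)

lemma charFun_step_eq [IsProbabilityMeasure P] (hmeas : ∀ k, Measurable (ξ k))
    (hsymm : ∀ a : ℤ, P.real {ω | ξ 0 ω = a} = P.real {ω | ξ 0 ω = -a}) (θ : ℝ) :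
    charFun (P.map fun ω => (ξ 0 ω : ℝ)) θ = (stepChar P ξ θ : ℂ) := by
  have h1 : P.map (fun ω => (ξ 0 ω : ℝ)) = P.map (fun ω => (-1 : ℝ) * (ξ 0 ω : ℝ)) := by
    have := ((identDistrib_neg_step hmeas hsymm).comp
      (measurable_from_top (f := fun a : ℤ => (a : ℝ)))).map_eq
    simpa [Function.comp_def] using this
  have h2 : charFun (P.map fun ω => (ξ 0 ω : ℝ)) θ
      = (starRingEnd ℂ) (charFun (P.map fun ω => (ξ 0 ω : ℝ)) θ) := by
    conv_lhs => rw [h1, charFun_map_mul_comp (measurable_castStep hmeas 0).aemeasurable,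
      neg_one_mul, charFun_neg]
  exact (Complex.conj_eq_iff_re.1 h2.symm).symm

lemma stepChar_eq_integral [IsProbabilityMeasure P] (hmeas : ∀ k, Measurable (ξ k)) (θ : ℝ) :
    stepChar P ξ θ = ∫ ω, Real.cos (θ * ξ 0 ω) ∂P := by
  have hX := measurable_castStep hmeas 0
  rw [stepChar, charFun_apply_real, integral_map hX.aemeasurable (by fun_prop)]
  have hint : Integrable (fun ω => Complex.exp (θ * (ξ 0 ω : ℝ) * Complex.I)) P := by
    refine Integrable.of_bound (C := 1) (by fun_prop) (ae_of_all _ fun ω => ?_)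
    rw [← Complex.ofReal_mul, Complex.norm_exp_ofReal_mul_I]
  have h := Complex.reCLM.integral_comp_comm hint
  simp only [Complex.reCLM_apply] at h
  rw [← h]
  refine integral_congr_ae (ae_of_all _ fun ω => ?_)
  change (Complex.exp (θ * (ξ 0 ω : ℝ) * Complex.I)).re = _
  rw [← Complex.ofReal_mul, Complex.exp_ofReal_mul_I_re]

lemma continuous_stepChar [IsProbabilityMeasure P] (hmeas : ∀ k, Measurable (ξ k)) :
    Continuous (stepChar P ξ) := by
  have : IsProbabilityMeasure (P.map fun ω => (ξ 0 ω : ℝ)) :=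
    Measure.isProbabilityMeasure_map (measurable_castStep hmeas 0).aemeasurable
  exact Complex.continuous_re.comp continuous_charFun

lemma integrable_cos_step [IsProbabilityMeasure P] (hmeas : ∀ k, Measurable (ξ k)) (θ : ℝ) :
    Integrable (fun ω => Real.cos (θ * ξ 0 ω)) P := by
  have hX := measurable_castStep hmeas 0
  refine Integrable.of_bound (C := 1) (by fun_prop) (ae_of_all _ fun ω => ?_)
  exact Real.abs_cos_le_one _

/-- If `cos (θ ξ)` has mean `s = ± 1`, then `cos (θ a) = s` for every possible step `a`. -/
lemma cos_eq_of_stepChar_eq [IsProbabilityMeasure P] (hmeas : ∀ k, Measurable (ξ k)) {θ s : ℝ}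
    (hs : s = 1 ∨ s = -1) (h : stepChar P ξ θ = s) {a : ℤ} (ha : 0 < P.real {ω | ξ 0 ω = a}) :
    Real.cos (θ * a) = s := by
  have hint := integrable_cos_step hmeas (P := P) θ
  have h0 : ∫ ω, (1 - s * Real.cos (θ * ξ 0 ω)) ∂P = 0 := by
    rw [integral_sub (integrable_const _) (hint.const_mul s), integral_const_mul,
      ← stepChar_eq_integral hmeas, h]
    rcases hs with rfl | rfl <;> simp
  have hnn : ∀ ω, 0 ≤ 1 - s * Real.cos (θ * ξ 0 ω) := fun ω => by
    have h1 := Real.neg_one_le_cos (θ * ξ 0 ω)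
    have h2 := Real.cos_le_one (θ * ξ 0 ω)
    rcases hs with rfl | rfl <;> linarith
  rw [integral_eq_zero_iff_of_nonneg hnn ((integrable_const _).sub (hint.const_mul s))] at h0
  by_contra hne
  have : P {ω | ξ 0 ω = a} = 0 := by
    refine measure_mono_null ?_ (ae_iff.1 h0)
    intro ω hω
    simp only [Set.mem_ofPred_eq] at hω
    simp only [Set.mem_ofPred_eq, hω, Pi.zero_apply]
    intro h3
    apply hne
    rcases hs with rfl | rfl <;> linarith
  rw [measureReal_def, this] at ha
  simp at ha

lemma abs_stepChar_le_one [IsProbabilityMeasure P] (hmeas : ∀ k, Measurable (ξ k)) (θ : ℝ) :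
    |stepChar P ξ θ| ≤ 1 := by
  have : IsProbabilityMeasure (P.map fun ω => (ξ 0 ω : ℝ)) :=
    Measure.isProbabilityMeasure_map (measurable_castStep hmeas 0).aemeasurable
  exact (Complex.abs_re_le_norm _).trans (norm_charFun_le_one θ)

/-- Aperiodicity: the frequencies at which the characteristic function has modulus one
form `2πℤ`. -/
lemma abs_stepChar_lt_one [IsProbabilityMeasure P] (hmeas : ∀ k, Measurable (ξ k))
    (haper : AddSubgroup.closure {d : ℤ | ∃ a b : ℤ, 0 < P.real {ω | ξ 0 ω = a} ∧
      0 < P.real {ω | ξ 0 ω = b} ∧ d = a - b} = ⊤) {θ : ℝ} (h0 : θ ≠ 0) (hπ : |θ| ≤ Real.pi) :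
    |stepChar P ξ θ| < 1 := by
  refine lt_of_le_of_ne (abs_stepChar_le_one hmeas θ) fun h => ?_
  obtain ⟨s, hs, hθ⟩ : ∃ s : ℝ, (s = 1 ∨ s = -1) ∧ stepChar P ξ θ = s :=
    ⟨_, (eq_or_eq_neg_of_abs_eq h), rfl⟩
  -- the periods of `x ↦ exp (i θ x)` on `ℤ`
  let H : AddSubgroup ℤ :=
    { carrier := {d | ∃ k : ℤ, θ * d = k * (2 * Real.pi)}
      zero_mem' := ⟨0, by simp⟩
      add_mem' := by
        rintro a b ⟨k, hk⟩ ⟨l, hl⟩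
        exact ⟨k + l, by push_cast; linarith⟩
      neg_mem' := by
        rintro a ⟨k, hk⟩
        exact ⟨-k, by push_cast; linarith⟩ }
  have hle : AddSubgroup.closure {d : ℤ | ∃ a b : ℤ, 0 < P.real {ω | ξ 0 ω = a} ∧
      0 < P.real {ω | ξ 0 ω = b} ∧ d = a - b} ≤ H := by
    rw [AddSubgroup.closure_le]
    rintro d ⟨a, b, ha, hb, rfl⟩
    have hca := cos_eq_of_stepChar_eq hmeas hs hθ ha
    have hcb := cos_eq_of_stepChar_eq hmeas hs hθ hb
    have hs2 : s * s = 1 := by rcases hs with rfl | rfl <;> norm_num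
    have hsa : Real.sin (θ * a) = 0 := by
      have := Real.sin_sq_add_cos_sq (θ * a)
      rw [hca, pow_two s, hs2] at this
      exact pow_eq_zero_iff (two_ne_zero) |>.1 (by linarith)
    have hc : Real.cos (θ * a - θ * b) = 1 := by
      rw [Real.cos_sub, hca, hcb, hsa, zero_mul, add_zero, hs2]
    obtain ⟨k, hk⟩ := (Real.cos_eq_one_iff _).1 hc
    exact ⟨k, by push_cast; linarith⟩
  have h1 : (1 : ℤ) ∈ H := hle (haper ▸ AddSubgroup.mem_top _)
  obtain ⟨k, hk⟩ := h1
  simp only [Int.cast_one, mul_one] at hk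
  have hk0 : k ≠ 0 := by
    rintro rfl
    exact h0 (by simpa using hk)
  have hk1 : (1 : ℝ) ≤ |(k : ℝ)| := by exact_mod_cast Int.one_le_abs hk0
  have hpos := Real.pi_pos
  rw [hk, abs_mul, abs_of_pos (by positivity : (0 : ℝ) < 2 * Real.pi)] at hπ
  nlinarith

/-- Exponential tails are more than enough for a second moment. -/
lemma integrable_sq_step [IsProbabilityMeasure P] (hmeas : ∀ k, Measurable (ξ k))
    (htail : ∃ β : ℝ, 0 < β ∧ ∃ C : ℝ, ∀ t : ℕ,
      P.real {ω | (t : ℤ) < |ξ 0 ω|} ≤ C * Real.exp (-β * t)) :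
    Integrable (fun ω => (ξ 0 ω : ℝ) ^ 2) P := by
  obtain ⟨β, hβ, C, hC⟩ := htail
  have hX := measurable_castStep hmeas 0
  refine ⟨by fun_prop, ?_⟩
  have hE : ∀ t : ℕ, MeasurableSet {ω | (t : ℤ) < |ξ 0 ω|} := fun t =>
    hmeas 0 (MeasurableSet.of_discrete (s := {a : ℤ | (t : ℤ) < |a|}))
  have hsq : ∀ ω, ‖(ξ 0 ω : ℝ) ^ 2‖ₑ
      = ∑' t : ℕ, ENNReal.ofReal (2 * t + 1) * {ω | (t : ℤ) < |ξ 0 ω|}.indicator 1 ω := by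
    intro ω
    obtain ⟨m, hm⟩ : ∃ m : ℕ, |ξ 0 ω| = m := ⟨(ξ 0 ω).natAbs, by simp⟩
    have hm' : (ξ 0 ω : ℝ) ^ 2 = (m : ℝ) ^ 2 := by
      have : ((|ξ 0 ω| : ℤ) : ℝ) = m := by rw [hm]; simp
      rw [← this, Int.cast_abs, sq_abs]
    rw [tsum_eq_sum (s := Finset.range m)]
    · rw [Finset.sum_congr rfl (g := fun t : ℕ => ENNReal.ofReal (2 * t + 1))]
      · rw [← ENNReal.ofReal_sum_of_nonneg fun t _ => by positivity, hm',
          Real.enorm_of_nonneg (by positivity)]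
        congr 1
        clear hm hm'
        induction m with
        | zero => simp
        | succ m ih => rw [Finset.sum_range_succ, ← ih]; push_cast; ring
      · intro t ht
        have : (t : ℤ) < |ξ 0 ω| := by rw [hm]; exact_mod_cast Finset.mem_range.1 ht
        simp [this]
    · intro t ht
      have : ¬ (t : ℤ) < |ξ 0 ω| := by
        rw [hm]; simpa using ht
      simp [this]
  rw [HasFiniteIntegral]
  simp only [hsq]
  rw [lintegral_tsum fun t => ((measurable_one.indicator (hE t)).const_mul _).aemeasurable]
  have hbound : ∀ t : ℕ, ∫⁻ ω, ENNReal.ofReal (2 * t + 1)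
      * {ω | (t : ℤ) < |ξ 0 ω|}.indicator 1 ω ∂P
      ≤ ENNReal.ofReal ((2 * t + 1) * (|C| * Real.exp (-β) ^ t)) := by
    intro t
    rw [lintegral_const_mul _ (measurable_one.indicator (hE t)), lintegral_indicator_one (hE t),
      ENNReal.ofReal_mul (by positivity)]
    gcongr
    rw [← ENNReal.ofReal_toReal (measure_ne_top P _)]
    refine ENNReal.ofReal_le_ofReal ((hC t).trans ?_)
    rw [← Real.exp_nat_mul, mul_comm (t : ℝ)]
    gcongr
    exact le_abs_self C
  refine lt_of_le_of_lt (ENNReal.tsum_le_tsum hbound) ?_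
  have hr : ‖Real.exp (-β)‖ < 1 := by
    rw [Real.norm_of_nonneg (by positivity), Real.exp_lt_one_iff]; linarith
  have hsum : Summable fun t : ℕ => (2 * (t : ℝ) + 1) * (|C| * Real.exp (-β) ^ t) := by
    have h1 := (summable_pow_mul_geometric_of_norm_lt_one 1 hr).mul_left (2 * |C|)
    have h2 := (summable_geometric_of_norm_lt_one hr).mul_left |C|
    refine (h1.add h2).congr fun t => ?_
    ring
  rw [← ENNReal.ofReal_tsum_of_nonneg (fun t => by positivity) hsum]
  exact ENNReal.ofReal_lt_top

lemma exists_pos_step [IsProbabilityMeasure P]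
    (hsymm : ∀ a : ℤ, P.real {ω | ξ 0 ω = a} = P.real {ω | ξ 0 ω = -a})
    (haper : AddSubgroup.closure {d : ℤ | ∃ a b : ℤ, 0 < P.real {ω | ξ 0 ω = a} ∧
      0 < P.real {ω | ξ 0 ω = b} ∧ d = a - b} = ⊤) :
    ∃ y : ℕ, 0 < y ∧ 0 < P.real {ω | ξ 0 ω = (y : ℤ)} := by
  by_contra! hcon
  have hzero : ∀ a : ℤ, 0 < P.real {ω | ξ 0 ω = a} → a = 0 := by
    intro a ha
    rcases lt_trichotomy a 0 with h | h | h
    · rw [hsymm] at ha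
      have := hcon a.natAbs (by omega)
      rw [show ((a.natAbs : ℕ) : ℤ) = -a by omega] at this
      exact absurd ha (not_lt.2 this)
    · exact h
    · have := hcon a.natAbs (by omega)
      rw [show ((a.natAbs : ℕ) : ℤ) = a by omega] at this
      exact absurd ha (not_lt.2 this)
  have hle : AddSubgroup.closure {d : ℤ | ∃ a b : ℤ, 0 < P.real {ω | ξ 0 ω = a} ∧
      0 < P.real {ω | ξ 0 ω = b} ∧ d = a - b} ≤ ⊥ := by
    rw [AddSubgroup.closure_le]
    rintro d ⟨a, b, ha, hb, rfl⟩
    simp [hzero a ha, hzero b hb]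
  have : (1 : ℤ) ∈ (⊥ : AddSubgroup ℤ) := hle (haper ▸ AddSubgroup.mem_top _)
  simp at this

lemma integral_sq_step_pos [IsProbabilityMeasure P]
    (hint : Integrable (fun ω => (ξ 0 ω : ℝ) ^ 2) P) {y : ℕ} (hy : 0 < y)
    (hpy : 0 < P.real {ω | ξ 0 ω = (y : ℤ)}) : 0 < ∫ ω, (ξ 0 ω : ℝ) ^ 2 ∂P := by
  refine lt_of_le_of_ne (integral_nonneg fun ω => sq_nonneg _) fun h => ?_
  rw [eq_comm, integral_eq_zero_iff_of_nonneg (fun ω => sq_nonneg _) hint] at h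
  have : P {ω | ξ 0 ω = (y : ℤ)} = 0 := by
    refine measure_mono_null ?_ (ae_iff.1 h)
    intro ω hω
    simp only [Set.mem_ofPred_eq] at hω
    simp [Set.mem_ofPred_eq, hω, hy.ne']
  rw [measureReal_def, this] at hpy
  simp at hpy

lemma integral_step_eq_zero [IsProbabilityMeasure P] (hmeas : ∀ k, Measurable (ξ k))
    (hsymm : ∀ a : ℤ, P.real {ω | ξ 0 ω = a} = P.real {ω | ξ 0 ω = -a}) :
    ∫ ω, (ξ 0 ω : ℝ) ∂P = 0 := by
  have h := ((identDistrib_neg_step hmeas hsymm).comp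
    (measurable_from_top (f := fun a : ℤ => (a : ℝ)))).integral_eq
  simp only [Function.comp_def, Int.cast_neg, integral_neg] at h
  linarith

/-- The characteristic function of a step in terms of the one of the normalised step. -/
lemma stepChar_eq_normalized [IsProbabilityMeasure P] (hmeas : ∀ k, Measurable (ξ k)) {σ : ℝ}
    (hσ : 0 < σ) (θ : ℝ) :
    stepChar P ξ θ = (charFun (P.map fun ω => σ⁻¹ * (ξ 0 ω : ℝ)) (σ * θ)).re := by
  rw [charFun_map_mul_comp (measurable_castStep hmeas 0).aemeasurable, ← mul_assoc,
    inv_mul_cancel₀ hσ.ne', one_mul, stepChar]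

lemma integral_sq_normalized {σ : ℝ} (hσ : 0 < σ)
    (hσ2 : σ ^ 2 = ∫ ω, (ξ 0 ω : ℝ) ^ 2 ∂P) :
    ∫ ω, ((fun ω => σ⁻¹ * (ξ 0 ω : ℝ)) ^ 2) ω ∂P = 1 := by
  simp only [Pi.pow_apply, mul_pow]
  rw [integral_const_mul, ← hσ2, ← mul_pow, inv_mul_cancel₀ hσ.ne', one_pow]

lemma tendsto_stepChar_pow [IsProbabilityMeasure P] (hmeas : ∀ k, Measurable (ξ k))
    (hsymm : ∀ a : ℤ, P.real {ω | ξ 0 ω = a} = P.real {ω | ξ 0 ω = -a}) {σ : ℝ}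
    (hσ : 0 < σ) (hσ2 : σ ^ 2 = ∫ ω, (ξ 0 ω : ℝ) ^ 2 ∂P) (t : ℝ) :
    Tendsto (fun n : ℕ => stepChar P ξ (t / √n) ^ n) atTop
      (nhds (Real.exp (-(σ ^ 2 / 2) * t ^ 2))) := by
  have hX := measurable_castStep hmeas 0
  have h := tendsto_charFun_inv_sqrt_mul_pow (P := P) (X := fun ω => σ⁻¹ * (ξ 0 ω : ℝ))
    (by fun_prop) (by rw [integral_const_mul, integral_step_eq_zero hmeas hsymm, mul_zero])
    (integral_sq_normalized hσ hσ2) (σ * t)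
  have h2 := (Complex.continuous_re.tendsto _).comp h
  have he : (Complex.exp (-((σ * t : ℝ) : ℂ) ^ 2 / 2)).re
      = Real.exp (-(σ ^ 2 / 2) * t ^ 2) := by
    have : (-((σ * t : ℝ) : ℂ) ^ 2 / 2) = ((-(σ ^ 2 / 2) * t ^ 2 : ℝ) : ℂ) := by
      push_cast; ring
    rw [this, Complex.exp_ofReal_re]
  rw [he] at h2
  refine h2.congr fun n => ?_
  have h3 : charFun (P.map fun ω => σ⁻¹ * (ξ 0 ω : ℝ)) ((√n)⁻¹ * (σ * t))
      = (stepChar P ξ (t / √n) : ℂ) := by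
    rw [← charFun_step_eq hmeas hsymm, charFun_map_mul_comp hX.aemeasurable]
    congr 1
    field_simp
  simp only [Function.comp_apply, h3]
  rw [← Complex.ofReal_pow, Complex.ofReal_re]

/-- The characteristic function lies below a Gaussian on the whole period. -/
lemma exists_abs_stepChar_le_exp [IsProbabilityMeasure P] (hmeas : ∀ k, Measurable (ξ k))
    (hsymm : ∀ a : ℤ, P.real {ω | ξ 0 ω = a} = P.real {ω | ξ 0 ω = -a})
    (haper : AddSubgroup.closure {d : ℤ | ∃ a b : ℤ, 0 < P.real {ω | ξ 0 ω = a} ∧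
      0 < P.real {ω | ξ 0 ω = b} ∧ d = a - b} = ⊤) {σ : ℝ}
    (hσ : 0 < σ) (hσ2 : σ ^ 2 = ∫ ω, (ξ 0 ω : ℝ) ^ 2 ∂P) :
    ∃ a : ℝ, 0 < a ∧ ∀ θ : ℝ, |θ| ≤ Real.pi → |stepChar P ξ θ| ≤ Real.exp (-a * θ ^ 2) := by
  have hX := measurable_castStep hmeas 0
  have h := taylor_charFun_two (P := P) (X := fun ω => σ⁻¹ * (ξ 0 ω : ℝ))
    (by fun_prop) (by rw [integral_const_mul, integral_step_eq_zero hmeas hsymm, mul_zero])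
    (integral_sq_normalized hσ hσ2)
  have h1 := h.def (c := 1 / 4) (by norm_num)
  have h2 : Tendsto (fun θ : ℝ => σ * θ) (nhds 0) (nhds 0) := by
    simpa using (continuous_const_mul σ).tendsto (0 : ℝ)
  -- near the origin, by the second order expansion
  obtain ⟨δ, hδ, hnear⟩ : ∃ δ : ℝ, 0 < δ ∧ ∀ θ : ℝ, |θ| < δ →
      |stepChar P ξ θ| ≤ Real.exp (-(σ ^ 2 / 4) * θ ^ 2) := by
    have h3 : ∀ᶠ θ : ℝ in nhds 0, |θ| < 1 / σ := by
      have := Metric.ball_mem_nhds (0 : ℝ) (by positivity : 0 < 1 / σ)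
      filter_upwards [this] with θ hθ
      simpa using hθ
    obtain ⟨δ, hδ, hball⟩ := Metric.eventually_nhds_iff.1 ((h2.eventually h1).and h3)
    refine ⟨δ, hδ, fun θ hθ => ?_⟩
    obtain ⟨h4, h5⟩ := hball (y := θ) (by simpa using hθ)
    set φ := charFun (P.map fun ω => σ⁻¹ * (ξ 0 ω : ℝ)) (σ * θ) with hφ
    have h6 : |stepChar P ξ θ - (1 - (σ * θ) ^ 2 / 2)| ≤ 1 / 4 * (σ * θ) ^ 2 := by
      have h7 := (Complex.abs_re_le_norm _).trans h4
      rw [Real.norm_of_nonneg (by positivity)] at h7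
      rw [stepChar_eq_normalized hmeas hσ, ← hφ]
      have h8 : (1 - ((σ * θ : ℝ) : ℂ) ^ 2 / 2) = ((1 - (σ * θ) ^ 2 / 2 : ℝ) : ℂ) := by
        push_cast; ring
      rwa [h8, Complex.sub_re, Complex.ofReal_re] at h7
    rw [abs_le] at h6
    have h8 : (σ * θ) ^ 2 ≤ 1 := by
      rw [sq_le_one_iff_abs_le_one, abs_mul, abs_of_pos hσ]
      rw [lt_div_iff₀ hσ] at h5
      linarith
    have h9 := Real.add_one_le_exp (-(σ ^ 2 / 4) * θ ^ 2)
    rw [abs_le]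
    constructor <;> nlinarith [h6.1, h6.2]
  -- away from the origin, by compactness
  have hcompact : IsCompact {θ : ℝ | δ ≤ |θ| ∧ |θ| ≤ Real.pi} := by
    refine (isCompact_Icc (a := -Real.pi) (b := Real.pi)).of_isClosed_subset ?_ ?_
    · exact (isClosed_le continuous_const continuous_abs).inter
        (isClosed_le continuous_abs continuous_const)
    · exact fun θ hθ => abs_le.1 hθ.2
  obtain ⟨r, hr1, hr⟩ : ∃ r : ℝ, r < 1 ∧ ∀ θ : ℝ, δ ≤ |θ| → |θ| ≤ Real.pi →
      |stepChar P ξ θ| ≤ r := by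
    rcases Set.eq_empty_or_nonempty {θ : ℝ | δ ≤ |θ| ∧ |θ| ≤ Real.pi} with he | hne
    · refine ⟨0, one_pos, fun θ h1 h2 => ?_⟩
      have : θ ∈ {θ : ℝ | δ ≤ |θ| ∧ |θ| ≤ Real.pi} := ⟨h1, h2⟩
      rw [he] at this
      exact this.elim
    · obtain ⟨θ₀, hθ₀, hmax⟩ := hcompact.exists_isMaxOn hne
        (continuous_stepChar hmeas (P := P)).abs.continuousOn
      refine ⟨|stepChar P ξ θ₀|, abs_stepChar_lt_one hmeas haper ?_ hθ₀.2, fun θ h1 h2 =>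
        hmax (a := θ) ⟨h1, h2⟩⟩
      rintro rfl
      have := hθ₀.1
      simp at this
      linarith
  have hpi := Real.pi_pos
  refine ⟨min (σ ^ 2 / 4) ((1 - r) / Real.pi ^ 2),
    lt_min (by positivity) (div_pos (by linarith) (by positivity)), fun θ hθ => ?_⟩
  rcases lt_or_ge |θ| δ with hlt | hge
  · refine (hnear θ hlt).trans (Real.exp_le_exp.2 ?_)
    have := min_le_left (σ ^ 2 / 4) ((1 - r) / Real.pi ^ 2)
    nlinarith [sq_nonneg θ]
  · refine (hr θ hge hθ).trans ?_
    have h1 : θ ^ 2 ≤ Real.pi ^ 2 := sq_le_sq' (abs_le.1 hθ).1 (abs_le.1 hθ).2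
    have h2 : min (σ ^ 2 / 4) ((1 - r) / Real.pi ^ 2) * θ ^ 2 ≤ 1 - r := by
      calc _ ≤ (1 - r) / Real.pi ^ 2 * Real.pi ^ 2 := by
            have h3 : 0 ≤ (1 - r) / Real.pi ^ 2 := div_nonneg (by linarith) (by positivity)
            exact mul_le_mul (min_le_right _ _) h1 (sq_nonneg θ) h3
        _ = 1 - r := by field_simp
    have h3 := Real.add_one_le_exp (-min (σ ^ 2 / 4) ((1 - r) / Real.pi ^ 2) * θ ^ 2)
    linarith

end CharFun

/-! ### The local limit theorem -/

section LocalLimit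

variable {Ω : Type*} [MeasurableSpace Ω] {P : Measure Ω} {ξ : ℕ → Ω → ℤ}

lemma integral_cos_int_mul (k : ℤ) :
    ∫ θ in (-Real.pi)..Real.pi, Real.cos (θ * k) = if k = 0 then 2 * Real.pi else 0 := by
  split_ifs with h
  · simp [h]; ring
  · have hk : (k : ℝ) ≠ 0 := by exact_mod_cast h
    rw [intervalIntegral.integral_comp_mul_right (fun x => Real.cos x) hk, integral_cos]
    have h1 : Real.sin (Real.pi * k) = 0 := by rw [mul_comm]; exact Real.sin_int_mul_pi k
    rw [neg_mul, Real.sin_neg, h1]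
    simp

/-- The characteristic function of the walk at time `n`, shifted by `y`. -/
lemma integral_cos_walk [IsProbabilityMeasure P] (hmeas : ∀ k, Measurable (ξ k))
    (hindep : iIndepFun ξ P) (hident : ∀ k, IdentDistrib (ξ k) (ξ 0) P P)
    (hsymm : ∀ a : ℤ, P.real {ω | ξ 0 ω = a} = P.real {ω | ξ 0 ω = -a}) (n : ℕ) (y : ℤ) (θ : ℝ) :
    ∫ ω, Real.cos (θ * ((walk ξ 0 n ω - y : ℤ) : ℝ)) ∂P
      = stepChar P ξ θ ^ n * Real.cos (θ * y) := by
  have hcast : Measurable fun a : ℤ => (a : ℝ) := measurable_from_top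
  have hind : iIndepFun (fun k ω => (ξ k ω : ℝ)) P :=
    hindep.comp (fun _ a => (a : ℝ)) fun _ => hcast
  have hchar := (hind.restrict (Finset.range n)).charFun_map_fun_finsetSum_eq_prod
    (fun k _ => (measurable_castStep hmeas k).aemeasurable)
  have hlaw : ∀ k, P.map (fun ω => (ξ k ω : ℝ)) = P.map fun ω => (ξ 0 ω : ℝ) := fun k =>
    ((hident k).comp hcast).map_eq
  have hchar' := congrFun hchar θ
  simp only [hlaw, Finset.prod_const, Finset.card_range, Pi.pow_apply,
    charFun_step_eq hmeas hsymm] at hchar'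
  have hW : Measurable fun ω => ∑ k ∈ Finset.range n, (ξ k ω : ℝ) :=
    Finset.measurable_fun_sum _ fun k _ => measurable_castStep hmeas k
  rw [charFun_apply_real, integral_map hW.aemeasurable (by fun_prop)] at hchar'
  have hint : Integrable (fun ω => Complex.exp (θ * (∑ k ∈ Finset.range n, (ξ k ω : ℝ) : ℝ)
      * Complex.I) * Complex.exp (-(θ * y : ℝ) * Complex.I)) P := by
    refine Integrable.of_bound (C := 1) (by fun_prop) (ae_of_all _ fun ω => ?_)
    rw [norm_mul, ← Complex.ofReal_mul, Complex.norm_exp_ofReal_mul_I, ← Complex.ofReal_neg,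
      Complex.norm_exp_ofReal_mul_I, one_mul]
  have h := Complex.reCLM.integral_comp_comm hint
  simp only [Complex.reCLM_apply] at h
  rw [integral_mul_const, hchar', ← Complex.ofReal_pow, Complex.re_ofReal_mul, ← Complex.ofReal_neg,
    Complex.exp_ofReal_mul_I_re, Real.cos_neg] at h
  rw [← h]
  refine integral_congr_ae (ae_of_all _ fun ω => ?_)
  simp only
  rw [← Complex.exp_add, ← add_mul, ← Complex.ofReal_mul, ← Complex.ofReal_add,
    Complex.exp_ofReal_mul_I_re]
  congr 1
  simp only [walk, zero_add]
  push_cast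
  ring

/-- Fourier inversion for the law of the walk at time `n`. -/
lemma two_pi_mul_transProb [IsProbabilityMeasure P] (hmeas : ∀ k, Measurable (ξ k))
    (hindep : iIndepFun ξ P) (hident : ∀ k, IdentDistrib (ξ k) (ξ 0) P P)
    (hsymm : ∀ a : ℤ, P.real {ω | ξ 0 ω = a} = P.real {ω | ξ 0 ω = -a}) (n : ℕ) (y : ℤ) :
    2 * Real.pi * transProb P ξ n 0 y
      = ∫ θ in (-Real.pi)..Real.pi, stepChar P ξ θ ^ n * Real.cos (θ * y) := by
  have hπ : -Real.pi ≤ Real.pi := by linarith [Real.pi_pos]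
  have hW : Measurable (walk ξ 0 n) := measurable_walk hmeas 0 n
  have hWy : Measurable fun ω => ((walk ξ 0 n ω - y : ℤ) : ℝ) :=
    (measurable_from_top (f := fun a : ℤ => ((a - y : ℤ) : ℝ))).comp hW
  simp only [← integral_cos_walk hmeas hindep hident hsymm]
  rw [intervalIntegral.integral_of_le hπ, integral_integral_swap]
  · simp only [← intervalIntegral.integral_of_le hπ, integral_cos_int_mul, sub_eq_zero]
    have h : (fun ω => if walk ξ 0 n ω = y then 2 * Real.pi else 0)
        = {ω | walk ξ 0 n ω = y}.indicator fun _ => 2 * Real.pi := by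
      ext ω; simp [Set.indicator_apply]
    have hms : MeasurableSet {ω | walk ξ 0 n ω = y} := hW (measurableSet_singleton y)
    rw [h, integral_indicator_const _ hms, smul_eq_mul, mul_comm]
    rfl
  · refine Integrable.of_bound (C := 1) ?_ (ae_of_all _ fun x => Real.abs_cos_le_one _)
    refine (Real.measurable_cos.comp ?_).aestronglyMeasurable
    exact measurable_fst.mul (hWy.comp measurable_snd)

lemma two_pi_mul_transProb_mul_sqrt [IsProbabilityMeasure P] (hmeas : ∀ k, Measurable (ξ k))
    (hindep : iIndepFun ξ P) (hident : ∀ k, IdentDistrib (ξ k) (ξ 0) P P)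
    (hsymm : ∀ a : ℤ, P.real {ω | ξ 0 ω = a} = P.real {ω | ξ 0 ω = -a}) {n : ℕ} (hn : 0 < n)
    (y : ℤ) :
    2 * Real.pi * (transProb P ξ n 0 y * √n)
      = ∫ t, (Set.Ioc (-(Real.pi * √n)) (Real.pi * √n)).indicator
          (fun t => stepChar P ξ (t / √n) ^ n * Real.cos (t / √n * y)) t := by
  have hs : 0 < √(n : ℝ) := by positivity
  have hle : -(Real.pi * √n) ≤ Real.pi * √n := by
    have : 0 < Real.pi * √n := mul_pos Real.pi_pos hs
    linarith
  rw [integral_indicator measurableSet_Ioc, ← intervalIntegral.integral_of_le hle,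
    intervalIntegral.integral_comp_div (fun θ => stepChar P ξ θ ^ n * Real.cos (θ * y)) hs.ne',
    neg_div, mul_div_assoc, div_self hs.ne', mul_one, smul_eq_mul,
    ← two_pi_mul_transProb hmeas hindep hident hsymm]
  ring

lemma abs_stepChar_pow_le {a : ℝ}
    (hbd : ∀ θ : ℝ, |θ| ≤ Real.pi → |stepChar P ξ θ| ≤ Real.exp (-a * θ ^ 2)) {n : ℕ} (hn : 0 < n)
    {t : ℝ} (ht : t ∈ Set.Ioc (-(Real.pi * √n)) (Real.pi * √n)) :
    |stepChar P ξ (t / √n) ^ n| ≤ Real.exp (-a * t ^ 2) := by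
  have hs : 0 < √(n : ℝ) := by positivity
  have h1 : |t / √n| ≤ Real.pi := by
    rw [abs_div, abs_of_pos hs, div_le_iff₀ hs]
    exact abs_le.2 ⟨ht.1.le, ht.2⟩
  rw [abs_pow]
  calc _ ≤ Real.exp (-a * (t / √n) ^ 2) ^ n := by gcongr; exact hbd _ h1
    _ = Real.exp (-a * t ^ 2) := by
      rw [← Real.exp_nat_mul, div_pow, Real.sq_sqrt (by positivity)]
      congr 1
      have : (n : ℝ) ≠ 0 := by positivity
      field_simp

/-- The local limit theorem, with a uniform bound and a bound for the dependence on the end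
point. -/
theorem exists_local_limit [IsProbabilityMeasure P] (hmeas : ∀ k, Measurable (ξ k))
    (hindep : iIndepFun ξ P) (hident : ∀ k, IdentDistrib (ξ k) (ξ 0) P P)
    (hsymm : ∀ a : ℤ, P.real {ω | ξ 0 ω = a} = P.real {ω | ξ 0 ω = -a})
    (htail : ∃ β : ℝ, 0 < β ∧ ∃ C : ℝ, ∀ t : ℕ,
      P.real {ω | (t : ℤ) < |ξ 0 ω|} ≤ C * Real.exp (-β * t))
    (haper : AddSubgroup.closure {d : ℤ | ∃ a b : ℤ, 0 < P.real {ω | ξ 0 ω = a} ∧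
      0 < P.real {ω | ξ 0 ω = b} ∧ d = a - b} = ⊤) :
    ∃ D D' κ : ℝ, 0 < κ ∧ (∀ (n : ℕ) (y : ℤ), transProb P ξ n 0 y * √n ≤ D) ∧
      (∀ (n : ℕ) (y : ℤ), 0 < n →
        |transProb P ξ n 0 y * √n - transProb P ξ n 0 0 * √n| ≤ D' * |(y : ℝ)| / √n) ∧
      Tendsto (fun n : ℕ => transProb P ξ n 0 0 * √n) atTop (nhds κ) := by
  obtain ⟨y₀, hy₀, hpy₀⟩ := exists_pos_step hsymm haper
  have hint2 := integrable_sq_step hmeas htail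
  have hvar := integral_sq_step_pos hint2 hy₀ hpy₀
  set σ := √(∫ ω, (ξ 0 ω : ℝ) ^ 2 ∂P) with hσdef
  have hσ : 0 < σ := Real.sqrt_pos.2 hvar
  have hσ2 : σ ^ 2 = ∫ ω, (ξ 0 ω : ℝ) ^ 2 ∂P := Real.sq_sqrt hvar.le
  obtain ⟨a, ha, hbd⟩ := exists_abs_stepChar_le_exp hmeas hsymm haper hσ hσ2
  have hπ := Real.pi_pos
  have hgi : Integrable fun t : ℝ => Real.exp (-a * t ^ 2) := integrable_exp_neg_mul_sq ha
  have hgi' : Integrable fun t : ℝ => |t| * Real.exp (-a * t ^ 2) := by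
    refine (integrable_mul_exp_neg_mul_sq ha).norm.congr (ae_of_all _ fun t => ?_)
    simp
  have hmeasF : ∀ (n : ℕ) (y : ℤ), AEStronglyMeasurable
      ((Set.Ioc (-(Real.pi * √n)) (Real.pi * √n)).indicator
        (fun t => stepChar P ξ (t / √n) ^ n * Real.cos (t / √n * y))) volume := by
    intro n y
    refine AEStronglyMeasurable.indicator ?_ measurableSet_Ioc
    have := continuous_stepChar hmeas (P := P)
    exact Continuous.aestronglyMeasurable (by fun_prop)
  have hF : ∀ (n : ℕ) (y : ℤ), 0 < n → ∀ t : ℝ,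
      ‖(Set.Ioc (-(Real.pi * √n)) (Real.pi * √n)).indicator
        (fun t => stepChar P ξ (t / √n) ^ n * Real.cos (t / √n * y)) t‖
        ≤ Real.exp (-a * t ^ 2) := by
    intro n y hn t
    rw [Set.indicator_apply]
    split_ifs with ht
    · rw [Real.norm_eq_abs, abs_mul]
      exact (mul_le_of_le_one_right (abs_nonneg _) (Real.abs_cos_le_one _)).trans
        (abs_stepChar_pow_le hbd hn ht)
    · rw [norm_zero]; positivity
  have hFi : ∀ (n : ℕ) (y : ℤ), 0 < n → Integrable
      ((Set.Ioc (-(Real.pi * √n)) (Real.pi * √n)).indicator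
        (fun t => stepChar P ξ (t / √n) ^ n * Real.cos (t / √n * y))) := fun n y hn =>
    hgi.mono' (hmeasF n y) (ae_of_all _ (hF n y hn))
  refine ⟨(∫ t, Real.exp (-a * t ^ 2)) / (2 * Real.pi),
    (∫ t, |t| * Real.exp (-a * t ^ 2)) / (2 * Real.pi),
    (∫ t, Real.exp (-(σ ^ 2 / 2) * t ^ 2)) / (2 * Real.pi), ?_, ?_, ?_, ?_⟩
  · rw [integral_gaussian]
    positivity
  · intro n y
    rcases Nat.eq_zero_or_pos n with rfl | hn
    · simp only [Nat.cast_zero, Real.sqrt_zero, mul_zero]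
      positivity
    · rw [le_div_iff₀ (by positivity), mul_comm,
        two_pi_mul_transProb_mul_sqrt hmeas hindep hident hsymm hn]
      refine integral_mono (hFi n y hn) hgi fun t => ?_
      exact (le_abs_self _).trans (hF n y hn t)
  · intro n y hn
    have hs : 0 < √(n : ℝ) := by positivity
    have key : |2 * Real.pi * (transProb P ξ n 0 y * √n) - 2 * Real.pi * (transProb P ξ n 0 0 * √n)|
        ≤ (∫ t, |t| * Real.exp (-a * t ^ 2)) * (|(y : ℝ)| / √n) := by
      rw [two_pi_mul_transProb_mul_sqrt hmeas hindep hident hsymm hn,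
        two_pi_mul_transProb_mul_sqrt hmeas hindep hident hsymm hn,
        ← integral_sub (hFi n y hn) (hFi n 0 hn), ← integral_mul_const, ← Real.norm_eq_abs]
      refine norm_integral_le_of_norm_le (hgi'.mul_const _) (ae_of_all _ fun t => ?_)
      rw [Set.indicator_apply, Set.indicator_apply]
      split_ifs with ht
      · rw [← mul_sub, Real.norm_eq_abs, abs_mul]
        have h1 : |Real.cos (t / √n * y) - Real.cos (t / √n * (0 : ℤ))|
            ≤ |t| * (|(y : ℝ)| / √n) := by
          have h2 := Real.abs_cos_sub_cos_le (t / √n * y) (t / √n * (0 : ℤ))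
          refine h2.trans (le_of_eq ?_)
          rw [Int.cast_zero, mul_zero, sub_zero, abs_mul, abs_div, abs_of_pos hs]
          ring
        calc _ ≤ Real.exp (-a * t ^ 2) * (|t| * (|(y : ℝ)| / √n)) :=
              mul_le_mul (abs_stepChar_pow_le hbd hn ht) h1 (abs_nonneg _) (by positivity)
          _ = _ := by ring
      · simp only [sub_self, norm_zero]; positivity
    rw [← mul_sub, abs_mul, abs_of_pos (by positivity : (0 : ℝ) < 2 * Real.pi)] at key
    rw [div_mul_eq_mul_div, div_div, le_div_iff₀ (by positivity)]
    calc _ = 2 * Real.pi * |transProb P ξ n 0 y * √n - transProb P ξ n 0 0 * √n| * √n := by ring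
      _ ≤ (∫ t, |t| * Real.exp (-a * t ^ 2)) * (|(y : ℝ)| / √n) * √n := by gcongr
      _ = _ := by field_simp
  · have hlim : Tendsto (fun n : ℕ => ∫ t, (Set.Ioc (-(Real.pi * √n)) (Real.pi * √n)).indicator
        (fun t => stepChar P ξ (t / √n) ^ n * Real.cos (t / √n * (0 : ℤ))) t) atTop
        (nhds (∫ t, Real.exp (-(σ ^ 2 / 2) * t ^ 2))) := by
      refine tendsto_integral_filter_of_dominated_convergence _
        (Eventually.of_forall fun n => hmeasF n 0)
        ((eventually_gt_atTop 0).mono fun n hn => ae_of_all _ (hF n 0 hn)) hgi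
        (ae_of_all _ fun t => ?_)
      refine (tendsto_stepChar_pow hmeas hsymm hσ hσ2 t).congr' ?_
      have h1 : Tendsto (fun n : ℕ => Real.pi * √n) atTop atTop :=
        (Real.tendsto_sqrt_atTop.comp tendsto_natCast_atTop_atTop).const_mul_atTop hπ
      filter_upwards [h1.eventually_gt_atTop |t|] with n hn
      have ht : t ∈ Set.Ioc (-(Real.pi * √n)) (Real.pi * √n) :=
        ⟨(abs_lt.1 hn).1, (abs_lt.1 hn).2.le⟩
      rw [Set.indicator_of_mem ht]
      simp
    refine (hlim.div_const (2 * Real.pi)).congr' ?_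
    filter_upwards [eventually_gt_atTop 0] with n hn
    rw [← two_pi_mul_transProb_mul_sqrt hmeas hindep hident hsymm hn]
    field_simp

end LocalLimit

/-! ### Sums of powers -/

lemma inv_mul_sqrt_le {x : ℝ} (hx : 1 ≤ x) :
    1 / (x * √x) ≤ 4 * (1 / √x - 1 / √(x + 1)) := by
  set a := √x with ha
  set b := √(x + 1) with hb
  have ha2 : a * a = x := Real.mul_self_sqrt (by linarith)
  have hb2 : b * b = x + 1 := Real.mul_self_sqrt (by linarith)
  have ha0 : 0 < a := Real.sqrt_pos.2 (by linarith)
  have hb0 : 0 < b := Real.sqrt_pos.2 (by linarith)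
  have hab : a ≤ b := Real.sqrt_le_sqrt (by linarith)
  have hba : 2 * b ≤ 3 * a := by
    nlinarith
  have h1 : 1 / a - 1 / b = 1 / (a * b * (a + b)) := by
    have hba1 : (b - a) * (a + b) = 1 := by nlinarith
    field_simp
    linarith
  rw [h1, ← ha2, mul_one_div, div_le_div_iff₀ (by positivity) (by positivity)]
  have h2 : b * (a + b) ≤ 4 * (a * a) := by nlinarith
  calc 1 * (a * b * (a + b)) = a * (b * (a + b)) := by ring
    _ ≤ a * (4 * (a * a)) := by gcongr
    _ = _ := by ring

lemma sum_Ico_inv_mul_sqrt_le {M : ℕ} (hM : 1 ≤ M) (N : ℕ) :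
    ∑ m ∈ Finset.Ico M N, 1 / ((m : ℝ) * √m) ≤ 4 / √M := by
  rcases le_or_gt N M with h | h
  · rw [Finset.Ico_eq_empty_of_le h, Finset.sum_empty]; positivity
  have key : ∑ m ∈ Finset.Ico M N, 1 / ((m : ℝ) * √m) ≤ 4 * (1 / √M - 1 / √N) := by
    induction N, h.le using Nat.le_induction with
    | base => simp
    | succ N hN ih =>
      rw [Finset.sum_Ico_succ_top hN]
      rcases hN.eq_or_lt with rfl | hlt
      · simp only [Finset.Ico_self, Finset.sum_empty, zero_add]
        have := inv_mul_sqrt_le (x := (M : ℝ)) (by exact_mod_cast hM)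
        push_cast; exact this
      · have h1 := ih hlt
        have := inv_mul_sqrt_le (x := (N : ℝ)) (by exact_mod_cast hM.trans hN)
        push_cast; linarith
  refine key.trans ?_
  have : 0 ≤ 1 / √(N : ℝ) := by positivity
  calc 4 * (1 / √(M : ℝ) - 1 / √N) ≤ 4 * (1 / √M) := by linarith
    _ = _ := by ring

lemma sum_Ico_one_inv_sqrt_le (n : ℕ) : ∑ m ∈ Finset.Ico 1 (n + 1), 1 / √(m : ℝ) ≤ 2 * √n := by
  induction n with
  | zero => simp
  | succ n ih =>
    rw [Finset.sum_Ico_succ_top (by omega)]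
    have h1 : (0 : ℝ) ≤ n := Nat.cast_nonneg n
    have h2 := Real.mul_self_sqrt h1
    have h3 := Real.mul_self_sqrt (by positivity : (0 : ℝ) ≤ (n : ℝ) + 1)
    have h4 : 0 < √((n : ℝ) + 1) := by positivity
    have h5 : 1 / √((n : ℝ) + 1) ≤ 2 * √((n : ℝ) + 1) - 2 * √n := by
      rw [div_le_iff₀ h4]
      nlinarith [sq_nonneg (√((n : ℝ) + 1) - √n)]
    push_cast
    linarith

lemma sqrt_natCast_le_add {m n : ℕ} (hmn : m ≤ n) : √(n : ℝ) ≤ √m + √((n - m : ℕ) : ℝ) := by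
  have : (n : ℝ) = m + (n - m : ℕ) := by rw [← Nat.cast_add, Nat.add_sub_cancel' hmn]
  rw [this, Real.sqrt_le_left (by positivity)]
  nlinarith [Real.sq_sqrt (Nat.cast_nonneg (α := ℝ) m),
    Real.sq_sqrt (Nat.cast_nonneg (α := ℝ) (n - m)),
    mul_nonneg (Real.sqrt_nonneg (m : ℝ)) (Real.sqrt_nonneg ((n - m : ℕ) : ℝ))]

lemma sum_Ico_inv_sqrt_mul_inv_sqrt_le (n : ℕ) :
    ∑ m ∈ Finset.Ico 1 n, 1 / (√(m : ℝ) * √((n - m : ℕ) : ℝ)) ≤ 4 := by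
  rcases Nat.eq_zero_or_pos n with rfl | hn
  · simp
  have hs : 0 < √(n : ℝ) := by positivity
  have h1 : ∑ m ∈ Finset.Ico 1 n, 1 / √(m : ℝ) ≤ 2 * √n := by
    obtain ⟨n, rfl⟩ := Nat.exists_eq_succ_of_ne_zero hn.ne'
    refine (sum_Ico_one_inv_sqrt_le n).trans ?_
    gcongr; omega
  have h2 : ∑ m ∈ Finset.Ico 1 n, 1 / √((n - m : ℕ) : ℝ) ≤ 2 * √n := by
    refine le_trans (le_of_eq ?_) h1
    have := Finset.sum_Ico_reflect (fun m : ℕ => 1 / √(m : ℝ)) 1 (Nat.le_succ n)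
    simpa using this
  have h3 : √(n : ℝ) * ∑ m ∈ Finset.Ico 1 n, 1 / (√(m : ℝ) * √((n - m : ℕ) : ℝ))
      ≤ ∑ m ∈ Finset.Ico 1 n, 1 / √((n - m : ℕ) : ℝ) + ∑ m ∈ Finset.Ico 1 n, 1 / √(m : ℝ) := by
    rw [Finset.mul_sum, ← Finset.sum_add_distrib]
    refine Finset.sum_le_sum fun m hm => ?_
    obtain ⟨hm1, hm2⟩ := Finset.mem_Ico.1 hm
    have ha : 0 < √(m : ℝ) := Real.sqrt_pos.2 (by exact_mod_cast hm1)
    have hb : 0 < √((n - m : ℕ) : ℝ) := Real.sqrt_pos.2 (by exact_mod_cast Nat.sub_pos_of_lt hm2)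
    calc √(n : ℝ) * (1 / (√(m : ℝ) * √((n - m : ℕ) : ℝ)))
        ≤ (√m + √((n - m : ℕ) : ℝ)) * (1 / (√(m : ℝ) * √((n - m : ℕ) : ℝ))) := by
          gcongr; exact sqrt_natCast_le_add hm2.le
      _ = _ := by field_simp
  refine le_of_mul_le_mul_left (h3.trans ?_) hs
  linarith

lemma sum_Ico_convolution_le {M : ℕ} (hM : 1 ≤ M) (n : ℕ) :
    √(n : ℝ) * ∑ m ∈ Finset.Ico M n, 1 / ((m : ℝ) * √m) * (1 / √((n - m : ℕ) : ℝ)) ≤ 8 / √M := by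
  have hM0 : (0 : ℝ) < M := by exact_mod_cast hM
  have h3 : √(n : ℝ) * ∑ m ∈ Finset.Ico M n, 1 / ((m : ℝ) * √m) * (1 / √((n - m : ℕ) : ℝ))
      ≤ ∑ m ∈ Finset.Ico M n, 1 / ((m : ℝ) * √m)
        + 1 / √M * ∑ m ∈ Finset.Ico M n, 1 / (√(m : ℝ) * √((n - m : ℕ) : ℝ)) := by
    rw [Finset.mul_sum, Finset.mul_sum, ← Finset.sum_add_distrib]
    refine Finset.sum_le_sum fun m hm => ?_
    obtain ⟨hm1, hm2⟩ := Finset.mem_Ico.1 hm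
    have hm0 : (0 : ℝ) < m := by exact_mod_cast hM.trans hm1
    have ha : 0 < √(m : ℝ) := Real.sqrt_pos.2 hm0
    have hb : 0 < √((n - m : ℕ) : ℝ) := Real.sqrt_pos.2 (by exact_mod_cast Nat.sub_pos_of_lt hm2)
    have ha2 : √(m : ℝ) * √m = m := Real.mul_self_sqrt hm0.le
    have hMa : 1 / √(m : ℝ) ≤ 1 / √M := by gcongr
    calc √(n : ℝ) * (1 / ((m : ℝ) * √m) * (1 / √((n - m : ℕ) : ℝ)))
        ≤ (√m + √((n - m : ℕ) : ℝ)) * (1 / ((m : ℝ) * √m) * (1 / √((n - m : ℕ) : ℝ))) := by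
          gcongr; exact sqrt_natCast_le_add hm2.le
      _ = 1 / ((m : ℝ) * √m) + 1 / √m * (1 / (√(m : ℝ) * √((n - m : ℕ) : ℝ))) := by
          have h : 1 / ((m : ℝ) * √m) = 1 / √m * (1 / (√m * √m)) := by rw [ha2]; field_simp
          rw [h]; field_simp; ring
      _ ≤ _ := by gcongr
  refine h3.trans ?_
  have h4 := sum_Ico_inv_mul_sqrt_le hM n
  have h5 : ∑ m ∈ Finset.Ico M n, 1 / (√(m : ℝ) * √((n - m : ℕ) : ℝ)) ≤ 4 := by
    refine le_trans ?_ (sum_Ico_inv_sqrt_mul_inv_sqrt_le n)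
    exact Finset.sum_le_sum_of_subset_of_nonneg (Finset.Ico_subset_Ico_left hM)
      fun m _ _ => by positivity
  calc _ ≤ 4 / √(M : ℝ) + 1 / √M * 4 := by gcongr
    _ = _ := by ring

/-! ### Asymptotics of the killed walk -/

section Asymptotics

variable {p : ℤ → ℝ≥0∞}

/-- The sum of the `m`-step probabilities of the killed walk along the two segments that
occur in the key identity for the starting point `w` and the end point `z`. -/
noncomputable def segmentSum (p : ℤ → ℝ≥0∞) (w z m : ℕ) : ℝ :=
  ∑ i ∈ Finset.range w, (killedPow p m (i + 1) z).toReal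
    + ∑ i ∈ Finset.range z, (killedPow p m w i).toReal

lemma segmentSum_nonneg (p : ℤ → ℝ≥0∞) (w z m : ℕ) : 0 ≤ segmentSum p w z m :=
  add_nonneg (Finset.sum_nonneg fun _ _ => ENNReal.toReal_nonneg)
    (Finset.sum_nonneg fun _ _ => ENNReal.toReal_nonneg)

lemma stepPow_ne_top (hp : ∑' x, p x = 1) (n : ℕ) (x : ℤ) : stepPow p n x ≠ ∞ :=
  ne_top_of_le_ne_top ENNReal.one_ne_top (stepPow_le_one hp n x)

lemma killedPow_ne_top (hp : ∑' x, p x = 1) (n w z : ℕ) : killedPow p n w z ≠ ∞ :=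
  ne_top_of_le_ne_top (stepPow_ne_top hp n _) (killedPow_le_stepPow p n w z)

lemma natCast_mul_killedPow_apply (p : ℤ → ℝ≥0∞) (n w z : ℕ) :
    (n : ℝ≥0∞) * killedPow p n w z = ∑ m ∈ Finset.range n,
      (∑ i ∈ Finset.range w, stepPow p (n - m) ((i : ℤ) + 1 - w) * killedPow p m (i + 1) z
        + ∑ i ∈ Finset.range z, killedPow p m w i * stepPow p (n - m) ((z : ℤ) - i)) := by
  rw [← KernelMat.natCast_mul_apply, natCast_mul_killedPow, KernelMat.sum_apply,
    ← Finset.sum_range_reflect]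
  refine Finset.sum_congr rfl fun m hm => ?_
  have hm' := Finset.mem_range.1 hm
  rw [KernelMat.add_apply, KernelMat.mul_apply, KernelMat.mul_apply,
    show n - 1 - (n - 1 - m) = m by omega]
  have hk : n - 1 - m + 1 = n - m := by omega
  congr 1
  · rw [tsum_eq_zero_add' ENNReal.summable, tsum_eq_sum (s := Finset.range w)]
    · have h0 : freeDown p (n - 1 - m) w 0 = 0 := by simp [freeDown]
      rw [h0, zero_mul, zero_add]
      refine Finset.sum_congr rfl fun i hi => ?_
      have hi' : i + 1 ≤ w := Finset.mem_range.1 hi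
      simp [freeDown, hi', hk]
    · intro i hi
      have hi' : ¬ i + 1 ≤ w := by simpa using hi
      simp [freeDown, hi']
  · rw [tsum_eq_sum (s := Finset.range z)]
    · refine Finset.sum_congr rfl fun i hi => ?_
      have hi' : i < z := Finset.mem_range.1 hi
      simp [freeUp, hi', hk]
    · intro i hi
      have hi' : ¬ i < z := by simpa using hi
      simp [freeUp, hi']

lemma natCast_mul_killedPow_toReal (hp : ∑' x, p x = 1) (n w z : ℕ) :
    (n : ℝ) * (killedPow p n w z).toReal = ∑ m ∈ Finset.range n,
      (∑ i ∈ Finset.range w,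
          (stepPow p (n - m) ((i : ℤ) + 1 - w)).toReal * (killedPow p m (i + 1) z).toReal
        + ∑ i ∈ Finset.range z,
          (killedPow p m w i).toReal * (stepPow p (n - m) ((z : ℤ) - i)).toReal) := by
  have h := congrArg ENNReal.toReal (natCast_mul_killedPow_apply p n w z)
  have hf : ∀ (m k w z : ℕ) (y : ℤ), stepPow p k y * killedPow p m w z ≠ ∞ := fun m k w z y =>
    ENNReal.mul_ne_top (stepPow_ne_top hp k y) (killedPow_ne_top hp m w z)
  have hf' : ∀ (m k w z : ℕ) (y : ℤ), killedPow p m w z * stepPow p k y ≠ ∞ := fun m k w z y =>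
    ENNReal.mul_ne_top (killedPow_ne_top hp m w z) (stepPow_ne_top hp k y)
  rw [ENNReal.toReal_mul, ENNReal.toReal_natCast, ENNReal.toReal_sum fun m _ =>
    ENNReal.add_ne_top.2 ⟨ENNReal.sum_ne_top.2 fun i _ => hf _ _ _ _ _,
      ENNReal.sum_ne_top.2 fun i _ => hf' _ _ _ _ _⟩] at h
  rw [h]
  refine Finset.sum_congr rfl fun m _ => ?_
  rw [ENNReal.toReal_add (ENNReal.sum_ne_top.2 fun i _ => hf _ _ _ _ _)
    (ENNReal.sum_ne_top.2 fun i _ => hf' _ _ _ _ _),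
    ENNReal.toReal_sum fun i _ => hf _ _ _ _ _, ENNReal.toReal_sum fun i _ => hf' _ _ _ _ _]
  simp only [ENNReal.toReal_mul]

lemma natCast_mul_killedPow_le (hp : ∑' x, p x = 1) {n w z : ℕ} {b : ℕ → ℝ}
    (hb : ∀ m < n, ∀ y : ℤ, |y| ≤ max (w : ℤ) z → (stepPow p (n - m) y).toReal ≤ b m) :
    (n : ℝ) * (killedPow p n w z).toReal ≤ ∑ m ∈ Finset.range n, b m * segmentSum p w z m := by
  rw [natCast_mul_killedPow_toReal hp]
  refine Finset.sum_le_sum fun m hm => ?_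
  have hm' := Finset.mem_range.1 hm
  rw [segmentSum, mul_add, Finset.mul_sum, Finset.mul_sum]
  refine add_le_add (Finset.sum_le_sum fun i hi => ?_) (Finset.sum_le_sum fun i hi => ?_)
  · have hi' := Finset.mem_range.1 hi
    refine mul_le_mul_of_nonneg_right (hb m hm' _ (le_max_of_le_left ?_)) ENNReal.toReal_nonneg
    rw [abs_le]; constructor <;> omega
  · have hi' := Finset.mem_range.1 hi
    rw [mul_comm]
    refine mul_le_mul_of_nonneg_right (hb m hm' _ (le_max_of_le_right ?_)) ENNReal.toReal_nonneg
    rw [abs_le]; constructor <;> omega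

lemma le_natCast_mul_killedPow (hp : ∑' x, p x = 1) {n w z : ℕ} {a : ℕ → ℝ}
    (ha : ∀ m < n, ∀ y : ℤ, |y| ≤ max (w : ℤ) z → a m ≤ (stepPow p (n - m) y).toReal) :
    ∑ m ∈ Finset.range n, a m * segmentSum p w z m ≤ (n : ℝ) * (killedPow p n w z).toReal := by
  rw [natCast_mul_killedPow_toReal hp]
  refine Finset.sum_le_sum fun m hm => ?_
  have hm' := Finset.mem_range.1 hm
  rw [segmentSum, mul_add, Finset.mul_sum, Finset.mul_sum]
  refine add_le_add (Finset.sum_le_sum fun i hi => ?_) (Finset.sum_le_sum fun i hi => ?_)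
  · have hi' := Finset.mem_range.1 hi
    refine mul_le_mul_of_nonneg_right (ha m hm' _ (le_max_of_le_left ?_)) ENNReal.toReal_nonneg
    rw [abs_le]; constructor <;> omega
  · have hi' := Finset.mem_range.1 hi
    rw [mul_comm]
    refine mul_le_mul_of_nonneg_left (ha m hm' _ (le_max_of_le_right ?_)) ENNReal.toReal_nonneg
    rw [abs_le]; constructor <;> omega

lemma hasSum_segmentSum (hp : ∑' x, p x = 1) (hs : ∀ x, p (-x) = p x)
    (hc : greenFun p 1 1 ≠ ∞) (hU : ∀ z : ℕ, renewal p z ≠ ∞) {w z : ℕ} (hw : 0 < w)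
    (hz : 0 < z) :
    HasSum (segmentSum p w z)
      ((greenFun p 1 1).toReal * ((renewal p w).toReal * (renewal p z).toReal)) := by
  set f : ℕ → ℝ≥0∞ := fun m => ∑ i ∈ Finset.range w, killedPow p m (i + 1) z
    + ∑ i ∈ Finset.range z, killedPow p m w i with hf
  have hsum : ∑' m, f m = greenFun p 1 1 * (renewal p w * renewal p z) := by
    rw [← sum_greenFun_add_sum_greenFun hs w z hw hz, hf, ENNReal.tsum_add,
      Summable.tsum_finsetSum fun _ _ => ENNReal.summable,
      Summable.tsum_finsetSum fun _ _ => ENNReal.summable]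
    rfl
  have hne : ∑' m, f m ≠ ∞ := by
    rw [hsum]
    exact ENNReal.mul_ne_top hc (ENNReal.mul_ne_top (hU w) (hU z))
  have h1 := ENNReal.hasSum_toReal hne
  rw [← ENNReal.tsum_toReal_eq (fun m => ENNReal.ne_top_of_tsum_ne_top hne m), hsum,
    ENNReal.toReal_mul, ENNReal.toReal_mul] at h1
  refine h1.congr_fun fun m => ?_
  rw [segmentSum, hf, ENNReal.toReal_add
    (ENNReal.sum_ne_top.2 fun i _ => killedPow_ne_top hp _ _ _)
    (ENNReal.sum_ne_top.2 fun i _ => killedPow_ne_top hp _ _ _),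
    ENNReal.toReal_sum fun i _ => killedPow_ne_top hp _ _ _,
    ENNReal.toReal_sum fun i _ => killedPow_ne_top hp _ _ _]

lemma segmentSum_le (hU : ∀ z : ℕ, renewal p z ≠ ∞) {B : ℝ} (hB0 : 0 ≤ B)
    (hB : ∀ n w z : ℕ, 0 < n → 0 < w → 0 < z → (killedPow p n w z).toReal
      ≤ B * ((renewal p w).toReal * (renewal p z).toReal) / (n * √n))
    {w z m : ℕ} (hw : 0 < w) (hz : 0 < z) (hm : 0 < m) :
    segmentSum p w z m
      ≤ (w + z) * B * ((renewal p w).toReal * (renewal p z).toReal) * (1 / (m * √m)) := by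
  have h1 : ∀ i ∈ Finset.range w, (killedPow p m (i + 1) z).toReal
      ≤ B * ((renewal p w).toReal * (renewal p z).toReal) / (m * √m) := by
    intro i hi
    refine (hB m (i + 1) z hm (Nat.succ_pos i) hz).trans ?_
    gcongr
    exacts [hU _, renewal_mono p (Finset.mem_range.1 hi)]
  have h2 : ∀ i ∈ Finset.range z, (killedPow p m w i).toReal
      ≤ B * ((renewal p w).toReal * (renewal p z).toReal) / (m * √m) := by
    intro i hi
    rcases Nat.eq_zero_or_pos i with rfl | hi0
    · rw [killedPow_zero_right p m hw, ENNReal.toReal_zero]; positivity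
    · refine (hB m w i hm hw hi0).trans ?_
      gcongr
      exacts [hU _, renewal_mono p (Finset.mem_range.1 hi).le]
  refine (add_le_add (Finset.sum_le_sum h1) (Finset.sum_le_sum h2)).trans (le_of_eq ?_)
  simp only [Finset.sum_const, Finset.card_range, nsmul_eq_mul]
  ring

/-- Comparison of the killed walk with the product of the renewal functions.  The times `m < M` of
the key identity give the main term; the later ones contribute at most the order
`(w + z) / √M` relative to it. -/
lemma abs_killedPow_sub_le (hp : ∑' x, p x = 1) (hs : ∀ x, p (-x) = p x)
    (hc : greenFun p 1 1 ≠ ∞) (hU : ∀ z : ℕ, renewal p z ≠ ∞) {B D κ δ : ℝ} (hB0 : 0 ≤ B)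
    (hB : ∀ n w z : ℕ, 0 < n → 0 < w → 0 < z → (killedPow p n w z).toReal
      ≤ B * ((renewal p w).toReal * (renewal p z).toReal) / (n * √n))
    (hD : ∀ n x, (stepPow p n x).toReal * √n ≤ D) (hδ : 0 ≤ δ) (hδκ : δ ≤ κ)
    {n M w z : ℕ} (hM : 1 ≤ M) (hMn : M ≤ n) (hw : 0 < w) (hz : 0 < z)
    (hq : ∀ m < M, ∀ y : ℤ, |y| ≤ max (w : ℤ) z →
      |(stepPow p (n - m) y).toReal * √n - κ| ≤ δ) :
    |n * √n * (killedPow p n w z).toReal / ((renewal p w).toReal * (renewal p z).toReal)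
        - κ * (greenFun p 1 1).toReal|
      ≤ δ * (greenFun p 1 1).toReal + 8 * (D + κ) * B * ((w + z) / √M) := by
  set c := (greenFun p 1 1).toReal with hcdef
  set X := (renewal p w).toReal * (renewal p z).toReal with hX
  set H := segmentSum p w z with hH
  have hone : ∀ {i : ℕ}, 0 < i → 1 ≤ (renewal p i).toReal := fun hi => by
    simpa using ENNReal.toReal_mono (hU _) (one_le_renewal p hi)
  have hX0 : 0 < X := mul_pos (zero_lt_one.trans_le (hone hw)) (zero_lt_one.trans_le (hone hz))
  have hc0 : 0 ≤ c := ENNReal.toReal_nonneg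
  have hD0 : 0 ≤ D := le_trans (by positivity) (hD 0 0)
  have hκ : 0 ≤ κ := hδ.trans hδκ
  have hn : 0 < n := by omega
  have hsn : 0 < √(n : ℝ) := by positivity
  have hH0 : ∀ m, 0 ≤ H m := segmentSum_nonneg p w z
  have hsum := hasSum_segmentSum hp hs hc hU hw hz
  rw [← hH, ← hX, ← hcdef] at hsum
  set E : ℝ := (w + z) * B * X with hE
  have hE0 : 0 ≤ E := by positivity
  have hHle : ∀ m, 0 < m → H m ≤ E * (1 / (m * √m)) := fun m hm =>
    segmentSum_le hU hB0 hB hw hz hm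
  have hmain_le : ∑ m ∈ Finset.range M, H m ≤ c * X := sum_le_hasSum _ (fun m _ => hH0 m) hsum
  have hmain_ge : c * X - E * (4 / √M) ≤ ∑ m ∈ Finset.range M, H m := by
    rw [sub_le_iff_le_add]
    refine le_of_tendsto hsum.tendsto_sum_nat ?_
    filter_upwards [eventually_ge_atTop M] with N hN
    rw [← Finset.sum_range_add_sum_Ico _ hN]
    gcongr
    calc ∑ m ∈ Finset.Ico M N, H m ≤ ∑ m ∈ Finset.Ico M N, E * (1 / ((m : ℝ) * √m)) :=
          Finset.sum_le_sum fun m hm => hHle m (hM.trans (Finset.mem_Ico.1 hm).1)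
      _ ≤ _ := by
          rw [← Finset.mul_sum]
          exact mul_le_mul_of_nonneg_left (sum_Ico_inv_mul_sqrt_le hM N) hE0
  -- upper bound
  have hup := natCast_mul_killedPow_le hp (n := n) (w := w) (z := z)
    (b := fun m => if m < M then (κ + δ) / √n else D * (1 / √((n - m : ℕ) : ℝ))) (by
      intro m hm y hy
      split_ifs with h
      · rw [le_div_iff₀ hsn]
        linarith [(abs_le.1 (hq m h y hy)).2]
      · have : 0 < √((n - m : ℕ) : ℝ) :=
          Real.sqrt_pos.2 (by exact_mod_cast Nat.sub_pos_of_lt hm)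
        rw [mul_one_div, le_div_iff₀ this]
        exact hD _ _)
  rw [← Finset.sum_range_add_sum_Ico _ hMn] at hup
  have hup1 : ∑ m ∈ Finset.range M,
      (if m < M then (κ + δ) / √n else D * (1 / √((n - m : ℕ) : ℝ))) * H m
      ≤ (κ + δ) / √n * (c * X) := by
    rw [Finset.sum_congr rfl fun m hm => by rw [if_pos (Finset.mem_range.1 hm)], ← Finset.mul_sum]
    exact mul_le_mul_of_nonneg_left hmain_le (by positivity)
  have hup2 : √(n : ℝ) * ∑ m ∈ Finset.Ico M n,
      (if m < M then (κ + δ) / √n else D * (1 / √((n - m : ℕ) : ℝ))) * H m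
      ≤ D * E * (8 / √M) := by
    calc _ ≤ √(n : ℝ) * ∑ m ∈ Finset.Ico M n,
          D * E * (1 / ((m : ℝ) * √m) * (1 / √((n - m : ℕ) : ℝ))) := by
          refine mul_le_mul_of_nonneg_left (Finset.sum_le_sum fun m hm => ?_) hsn.le
          obtain ⟨h1, h2⟩ := Finset.mem_Ico.1 hm
          rw [if_neg (not_lt.2 h1)]
          calc _ ≤ D * (1 / √((n - m : ℕ) : ℝ)) * (E * (1 / (m * √m))) := by
                gcongr; exact hHle m (hM.trans h1)
            _ = _ := by ring
      _ = D * E * (√(n : ℝ) * ∑ m ∈ Finset.Ico M n,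
          (1 / ((m : ℝ) * √m) * (1 / √((n - m : ℕ) : ℝ)))) := by
          rw [← Finset.mul_sum]; ring
      _ ≤ _ := mul_le_mul_of_nonneg_left (sum_Ico_convolution_le hM n) (by positivity)
  -- lower bound
  have hlow := le_natCast_mul_killedPow hp (n := n) (w := w) (z := z)
    (a := fun m => if m < M then (κ - δ) / √n else 0) (by
      intro m hm y hy
      split_ifs with h
      · rw [div_le_iff₀ hsn]
        linarith [(abs_le.1 (hq m h y hy)).1]
      · exact ENNReal.toReal_nonneg)
  rw [← Finset.sum_range_add_sum_Ico _ hMn] at hlow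
  have hlow1 : (κ - δ) / √n * (c * X - E * (4 / √M)) ≤ ∑ m ∈ Finset.range M,
      (if m < M then (κ - δ) / √n else 0) * H m := by
    rw [Finset.sum_congr rfl fun m hm => by rw [if_pos (Finset.mem_range.1 hm)], ← Finset.mul_sum]
    exact mul_le_mul_of_nonneg_left hmain_ge (div_nonneg (by linarith) hsn.le)
  have hlow2 : 0 ≤ ∑ m ∈ Finset.Ico M n, (if m < M then (κ - δ) / √n else 0) * H m :=
    Finset.sum_nonneg fun m hm => by
      rw [if_neg (not_lt.2 (Finset.mem_Ico.1 hm).1), zero_mul]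
  set u := (killedPow p n w z).toReal with hu
  have hU1 : n * √n * u ≤ (κ + δ) * (c * X) + D * E * (8 / √M) := by
    calc (n : ℝ) * √n * u = √n * (n * u) := by ring
      _ ≤ √n * (_ + _) := mul_le_mul_of_nonneg_left hup hsn.le
      _ ≤ √n * ((κ + δ) / √n * (c * X)) + D * E * (8 / √M) := by
          rw [mul_add]
          exact add_le_add (mul_le_mul_of_nonneg_left hup1 hsn.le) hup2
      _ = _ := by field_simp
  have hL1 : (κ - δ) * (c * X - E * (4 / √M)) ≤ n * √n * u := by
    calc (κ - δ) * (c * X - E * (4 / √M)) = √n * ((κ - δ) / √n * (c * X - E * (4 / √M))) := by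
          field_simp
      _ ≤ √n * (n * u) := by
          refine mul_le_mul_of_nonneg_left ?_ hsn.le
          linarith
      _ = _ := by ring
  have hM0 : 0 ≤ 1 / √(M : ℝ) := by positivity
  have hEM : E * (8 / √M) = 8 * B * ((w + z) / √M) * X := by rw [hE]; ring
  have hT : 0 ≤ B * ((w + z) / √(M : ℝ)) := by positivity
  set T := B * (((w : ℝ) + z) / √(M : ℝ)) with hTdef
  have hEM8 : E * (8 / √M) = 8 * T * X := by rw [hEM]; ring
  have hEM4 : E * (4 / √M) = 4 * T * X := by
    have : E * (4 / √M) = E * (8 / √M) / 2 := by ring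
    rw [this, hEM8]; ring
  rw [mul_assoc D, hEM8] at hU1
  rw [hEM4] at hL1
  have hTX : 0 ≤ T * X := mul_nonneg hT hX0.le
  have hgoal : 8 * (D + κ) * B * ((w + z) / √M) = 8 * (D + κ) * T := by rw [hTdef]; ring
  rw [hgoal, abs_le]
  constructor
  · rw [neg_le_sub_iff_le_add, ← sub_le_iff_le_add, le_div_iff₀ hX0]
    have h1 : 0 ≤ D * (T * X) := mul_nonneg hD0 hTX
    have h2 : 0 ≤ κ * (T * X) := mul_nonneg hκ hTX
    have h3 : 0 ≤ δ * (T * X) := mul_nonneg hδ hTX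
    nlinarith
  · rw [sub_le_iff_le_add, div_le_iff₀ hX0]
    have h2 : 0 ≤ κ * (T * X) := mul_nonneg hκ hTX
    nlinarith

end Asymptotics

/-! ### Uniform limits -/

lemma tendsto_natCast_rpow_of_neg {s : ℝ} (hs : s < 0) :
    Tendsto (fun n : ℕ => (n : ℝ) ^ s) atTop (nhds 0) := by
  have h := (tendsto_rpow_neg_atTop (neg_pos.2 hs)).comp (tendsto_natCast_atTop_atTop (R := ℝ))
  simpa [Function.comp_def] using h

lemma eventually_mul_rpow_le_mul_sqrt {ε K η : ℝ} (hε : ε < 1 / 2) (hη : 0 < η) :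
    ∀ᶠ n : ℕ in atTop, K * (n : ℝ) ^ ε ≤ η * √n := by
  have h := (tendsto_natCast_rpow_of_neg (sub_neg.2 hε)).const_mul K
  rw [mul_zero] at h
  filter_upwards [h.eventually_le_const hη, eventually_gt_atTop 0] with n hn hn0
  have hn' : (0 : ℝ) < n := by exact_mod_cast hn0
  rw [show ε = (ε - 1 / 2) + 1 / 2 by ring, Real.rpow_add hn', ← mul_assoc, ← Real.sqrt_eq_rpow]
  gcongr

lemma eventually_ceil_rpow_le {γ η : ℝ} (hγ : γ < 1) (hη : 0 < η) :
    ∀ᶠ n : ℕ in atTop, (⌈(n : ℝ) ^ γ⌉₊ : ℝ) ≤ η * n := by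
  have h := tendsto_natCast_rpow_of_neg (sub_neg.2 hγ)
  have h1 := h.eventually_le_const (half_pos hη)
  have h2 := (tendsto_one_div_atTop_nhds_zero_nat (𝕜 := ℝ)).eventually_le_const (half_pos hη)
  filter_upwards [h1, h2, eventually_gt_atTop 0] with n hn hn1 hn0
  have hn' : (0 : ℝ) < n := by exact_mod_cast hn0
  rw [div_le_iff₀ hn'] at hn1
  rw [Real.rpow_sub_one hn'.ne', div_le_iff₀ hn'] at hn
  have := (Nat.ceil_lt_add_one (by positivity : 0 ≤ (n : ℝ) ^ γ)).le
  linarith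

/-- The local limit is uniform over end points of order `n ^ ε` and over times between
`n - n ^ γ` and `n`. -/
lemma eventually_abs_mul_sqrt_sub_le {q : ℕ → ℤ → ℝ} {D κ : ℝ}
    (h1 : ∀ (n : ℕ) (y : ℤ), 0 < n → |q n y * √n - q n 0 * √n| ≤ D * |(y : ℝ)| / √n)
    (h2 : Tendsto (fun n : ℕ => q n 0 * √n) atTop (nhds κ)) (hκ : 0 ≤ κ) {ε γ K δ : ℝ}
    (hε : ε < 1 / 2) (hγ : γ < 1) (hδ : 0 < δ) :
    ∀ᶠ n : ℕ in atTop, ∀ m < ⌈(n : ℝ) ^ γ⌉₊, ∀ y : ℤ, |(y : ℝ)| ≤ K * (n : ℝ) ^ ε →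
      |q (n - m) y * √n - κ| ≤ δ := by
  set η : ℝ := min (1 / 2) (δ / (2 + 4 * |D| + κ)) with hη
  have hden : 0 < 2 + 4 * |D| + κ := by positivity
  have hη0 : 0 < η := lt_min (by norm_num) (by positivity)
  have hη1 : η ≤ 1 / 2 := min_le_left _ _
  have hηδ : η * (2 + 4 * |D| + κ) ≤ δ := by
    rw [← le_div_iff₀ hden]; exact min_le_right _ _
  obtain ⟨N, hN⟩ := eventually_atTop.1 (Metric.tendsto_nhds.1 h2 η hη0)
  filter_upwards [eventually_ceil_rpow_le hγ hη0, eventually_mul_rpow_le_mul_sqrt (K := K) hε hη0,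
    eventually_ge_atTop (2 * N + 1)] with n hn1 hn2 hn3 m hm y hy
  have hn0 : (0 : ℝ) < n := by exact_mod_cast (by omega : 0 < n)
  have hm' : (m : ℝ) ≤ η * n := le_trans (by exact_mod_cast hm.le) hn1
  have hm2 : 2 * m ≤ n := by
    have : (2 : ℝ) * m ≤ n := by nlinarith
    exact_mod_cast this
  set k := n - m with hk
  have hkN : N ≤ k := by omega
  have hk0 : 0 < k := by omega
  have hkr : (k : ℝ) = n - m := by rw [hk, Nat.cast_sub (by omega)]
  have hk0' : (0 : ℝ) < k := by exact_mod_cast hk0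
  have hsk : 0 < √(k : ℝ) := Real.sqrt_pos.2 hk0'
  have hle1 : √(k : ℝ) ≤ √n := by
    apply Real.sqrt_le_sqrt
    have : (0 : ℝ) ≤ m := Nat.cast_nonneg m
    linarith
  have hle2 : √(n : ℝ) ≤ (1 + η) * √k := by
    rw [Real.sqrt_le_left (by positivity), mul_pow, Real.sq_sqrt hk0'.le, hkr]
    nlinarith [mul_nonneg (mul_nonneg hη0.le hη0.le) hn0.le, mul_nonneg hη0.le hn0.le]
  have hA : |q k y * √k - κ| ≤ η + |D| * (2 * η) := by
    have h3 := h1 k y hk0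
    have h4 := (hN k hkN).le
    rw [Real.dist_eq] at h4
    have h5 : |(y : ℝ)| / √k ≤ 2 * η := by
      rw [div_le_iff₀ hsk]
      have h7 : η * √n ≤ η * ((1 + η) * √k) := by gcongr
      have h8 : η * ((1 + η) * √k) ≤ 2 * η * √k := by nlinarith [mul_pos hη0 hsk]
      linarith
    have h6 : D * |(y : ℝ)| / √k ≤ |D| * (2 * η) := by
      rw [mul_div_assoc]
      exact mul_le_mul (le_abs_self D) h5 (by positivity) (abs_nonneg D)
    calc |q k y * √k - κ| = |(q k y * √k - q k 0 * √k) + (q k 0 * √k - κ)| := by ring_nf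
      _ ≤ _ := (abs_add_le _ _).trans (by linarith)
  set r := √(n : ℝ) / √k with hr
  have hr1 : 1 ≤ r := by rw [hr, le_div_iff₀ hsk]; linarith
  have hr2 : r ≤ 1 + η := by rw [hr, div_le_iff₀ hsk]; exact hle2
  have hdecomp : q k y * √n - κ = (q k y * √k - κ) * r + κ * (r - 1) := by
    rw [hr]; field_simp; ring
  rw [hdecomp]
  have hD0 := abs_nonneg D
  calc _ ≤ |(q k y * √k - κ) * r| + |κ * (r - 1)| := abs_add_le _ _
    _ = |q k y * √k - κ| * r + κ * (r - 1) := by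
        rw [abs_mul, abs_mul, abs_of_nonneg (by linarith : 0 ≤ r), abs_of_nonneg hκ,
          abs_of_nonneg (by linarith : 0 ≤ r - 1)]
    _ ≤ (η + |D| * (2 * η)) * 2 + κ * η := by
        gcongr <;> linarith
    _ = η * (2 + 4 * |D| + κ) := by ring
    _ ≤ δ := hηδ

/-! ### The ratio limit -/

section Conclusion

variable {Ω : Type*} [MeasurableSpace Ω] {P : Measure Ω} {ξ : ℕ → Ω → ℤ}

lemma transProb_eq [IsProbabilityMeasure P] (hmeas : ∀ k, Measurable (ξ k))
    (hindep : iIndepFun ξ P) (hident : ∀ k, IdentDistrib (ξ k) (ξ 0) P P) (n : ℕ) (w z : ℤ) :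
    transProb P ξ n w z = (stepPow (stepLaw P ξ) n (z - w)).toReal := by
  rw [transProb, measureReal_def, measure_walk_eq hmeas hindep hident]

lemma posTransProb_eq [IsProbabilityMeasure P] (hmeas : ∀ k, Measurable (ξ k))
    (hindep : iIndepFun ξ P) (hident : ∀ k, IdentDistrib (ξ k) (ξ 0) P P) (n w z : ℕ) :
    posTransProb P ξ n w z = (killedPow (stepLaw P ξ) n w z).toReal := by
  rw [← measure_stayPos hmeas hindep hident]; rfl

lemma ladderRenewal_eq [IsProbabilityMeasure P] (hmeas : ∀ k, Measurable (ξ k))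
    (hindep : iIndepFun ξ P) (hident : ∀ k, IdentDistrib (ξ k) (ξ 0) P P) (z : ℕ) :
    ladderRenewal P ξ z = (renewal (stepLaw P ξ) z).toReal := by
  rw [ladderRenewal, lintegral_ladderCount hmeas hindep hident]

lemma stepLaw_neg [IsProbabilityMeasure P]
    (hsymm : ∀ a : ℤ, P.real {ω | ξ 0 ω = a} = P.real {ω | ξ 0 ω = -a}) (a : ℤ) :
    stepLaw P ξ (-a) = stepLaw P ξ a := by
  have h := hsymm a
  rw [measureReal_def, measureReal_def, ENNReal.toReal_eq_toReal_iff' (measure_ne_top _ _)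
    (measure_ne_top _ _)] at h
  exact h.symm

end Conclusion

theorem mainTheorem5 {Ω : Type*} [MeasurableSpace Ω] (P : Measure Ω) [IsProbabilityMeasure P]
    (ξ : ℕ → Ω → ℤ)
    (hmeas : ∀ k : ℕ, Measurable (ξ k))
    (hindep : iIndepFun ξ P)
    (hident : ∀ k : ℕ, IdentDistrib (ξ k) (ξ 0) P P)
    -- the step distribution is symmetric
    (hsymm : ∀ a : ℤ, P.real {ω | ξ 0 ω = a} = P.real {ω | ξ 0 ω = -a})
    -- the step distribution has exponential tails
    (htail : ∃ β : ℝ, 0 < β ∧ ∃ C : ℝ, ∀ t : ℕ,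
      P.real {ω | (t : ℤ) < |ξ 0 ω|} ≤ C * Real.exp (-β * t))
    -- irreducible and aperiodic: differences of possible step values generate `ℤ`
    (haper : AddSubgroup.closure {d : ℤ | ∃ a b : ℤ, 0 < P.real {ω | ξ 0 ω = a} ∧
      0 < P.real {ω | ξ 0 ω = b} ∧ d = a - b} = ⊤) :
    (∀ z : ℤ, 0 < z → 0 < ladderRenewal P ξ z) ∧
    (∃ C : ℝ, ∀ z : ℤ, 0 < z → ladderRenewal P ξ z ≤ C * z) ∧
    ∃ c : ℝ, 0 < c ∧ ∀ ε : ℝ, 0 < ε → ε < 1 / 2 → ∀ K : ℝ, 0 < K →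
      RatioTendstoUniformly
        (fun n : ℕ => {i : ℤ × ℤ | 0 < i.1 ∧ (i.1 : ℝ) ≤ K * (n : ℝ) ^ ε ∧
          0 < i.2 ∧ (i.2 : ℝ) ≤ K * (n : ℝ) ^ ε})
        (fun (n : ℕ) (i : ℤ × ℤ) => posTransProb P ξ n i.1 i.2)
        (fun (n : ℕ) (i : ℤ × ℤ) =>
          ladderRenewal P ξ i.1 * ladderRenewal P ξ i.2 / n * transProb P ξ n i.1 i.2)
        c := by
  set p := stepLaw P ξ with hp_def
  have hp : ∑' x, p x = 1 := tsum_stepLaw hmeas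
  have hs : ∀ x, p (-x) = p x := stepLaw_neg hsymm
  have hUle : ∀ z : ℕ, renewal p z ≤ z := renewal_stepLaw_le hmeas hindep hident
  have hU : ∀ z : ℕ, renewal p z ≠ ∞ := fun z =>
    ne_top_of_le_ne_top (ENNReal.natCast_ne_top z) (hUle z)
  obtain ⟨y, hy, hpy⟩ := exists_pos_step hsymm haper
  have hpy' : p y ≠ 0 := by
    intro h
    change P {ω | ξ 0 ω = (y : ℤ)} = 0 at h
    rw [measureReal_def, h] at hpy
    simp at hpy
  have hc : greenFun p 1 1 ≠ ∞ := greenFun_one_one_ne_top hU hy hpy'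
  have hc1 : 1 ≤ (greenFun p 1 1).toReal := by
    have h : (1 : ℝ≥0∞) ≤ greenFun p 1 1 :=
      le_trans (by simp [killedPow_zero_apply]) (ENNReal.le_tsum 0)
    simpa using ENNReal.toReal_mono hc h
  have hpos : ∀ z : ℕ, 0 < z → 0 < (renewal p z).toReal := fun z hz =>
    ENNReal.toReal_pos (zero_lt_one.trans_le (one_le_renewal p hz)).ne' (hU z)
  refine ⟨fun z hz => ?_, ⟨1, fun z hz => ?_⟩, (greenFun p 1 1).toReal, by linarith,
    fun ε hε hε2 K hK => ?_⟩
  · lift z to ℕ using hz.le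
    rw [ladderRenewal_eq hmeas hindep hident]
    exact hpos z (by exact_mod_cast hz)
  · lift z to ℕ using hz.le
    rw [ladderRenewal_eq hmeas hindep hident, one_mul]
    simpa using ENNReal.toReal_mono (ENNReal.natCast_ne_top z) (hUle z)
  intro δ₀ hδ₀
  obtain ⟨D, D', κ, hκ, hD, hD', hlim⟩ :=
    exists_local_limit hmeas hindep hident hsymm htail haper
  simp only [transProb_eq hmeas hindep hident, sub_zero, ← hp_def] at hD hD' hlim
  obtain ⟨B, hB0, hB⟩ := killedPow_toReal_le hp hs hc hU hD
  set c := (greenFun p 1 1).toReal with hc_def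
  have hD0 : 0 ≤ D := le_trans (by positivity) (hD 0 0)
  -- the tolerance for numerator and denominator
  set δ : ℝ := min (κ / 2) (δ₀ * κ / (4 * (2 * c + 1))) with hδ_def
  have hδ : 0 < δ := lt_min (by positivity) (by positivity)
  have hδκ : δ ≤ κ / 2 := min_le_left _ _
  have hδc : (2 * c + 1) * δ ≤ δ₀ * κ / 4 := by
    calc (2 * c + 1) * δ ≤ (2 * c + 1) * (δ₀ * κ / (4 * (2 * c + 1))) := by
          gcongr; exact min_le_right _ _
      _ = δ₀ * κ / 4 := by field_simp
  set γ : ℝ := ε + 1 / 2 with hγ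
  have hγ1 : γ < 1 := by linarith
  have herr : ∀ᶠ n : ℕ in atTop,
      8 * (D + κ) * B * (2 * K) * (n : ℝ) ^ ((ε - 1 / 2) / 2) ≤ δ := by
    have h := (tendsto_natCast_rpow_of_neg (by linarith : (ε - 1 / 2) / 2 < 0)).const_mul
      (8 * (D + κ) * B * (2 * K))
    rw [mul_zero] at h
    exact h.eventually_le_const hδ
  filter_upwards [eventually_abs_mul_sqrt_sub_le (q := fun n y => (stepPow p n y).toReal) hD' hlim
    hκ.le (K := K) hε2 hγ1 hδ, eventually_ceil_rpow_le hγ1 one_pos, herr,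
    eventually_gt_atTop 0] with n hq hMn hn hn0
  rintro ⟨w, z⟩ ⟨hw, hwK, hz, hzK⟩
  simp only at hw hwK hz hzK ⊢
  lift w to ℕ using hw.le
  lift z to ℕ using hz.le
  rw [ladderRenewal_eq hmeas hindep hident, ladderRenewal_eq hmeas hindep hident,
    posTransProb_eq hmeas hindep hident, transProb_eq hmeas hindep hident, ← hp_def]
  have hw0 : 0 < w := by exact_mod_cast hw
  have hz0 : 0 < z := by exact_mod_cast hz
  have hn' : (0 : ℝ) < n := by exact_mod_cast hn0
  have hsn : 0 < √(n : ℝ) := Real.sqrt_pos.2 hn'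
  rw [Int.cast_natCast] at hwK hzK
  set M := ⌈(n : ℝ) ^ γ⌉₊ with hM
  have hM1 : 1 ≤ M := Nat.one_le_iff_ne_zero.2 (Nat.ceil_pos.2 (Real.rpow_pos_of_pos hn' γ)).ne'
  have hMn' : M ≤ n := by
    rw [one_mul] at hMn
    exact_mod_cast hMn
  have hmain := abs_killedPow_sub_le hp hs hc hU hB0 hB hD hδ.le (by linarith : δ ≤ κ) hM1 hMn'
    hw0 hz0 (fun m hm y hy => hq m hm y (by
      rw [← Int.cast_abs]
      have h1 : ((|y| : ℤ) : ℝ) ≤ ((max (w : ℤ) z : ℤ) : ℝ) := by exact_mod_cast hy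
      refine h1.trans ?_
      rw [Int.cast_max]
      exact max_le (by exact_mod_cast hwK) (by exact_mod_cast hzK)))
  rw [← hc_def] at hmain
  have hterm : 8 * (D + κ) * B * (((w : ℝ) + z) / √M) ≤ δ := by
    refine le_trans ?_ hn
    rw [mul_assoc _ (2 * K)]
    refine mul_le_mul_of_nonneg_left ?_ (by positivity)
    have hsM : (n : ℝ) ^ (γ / 2) ≤ √M := by
      rw [show γ / 2 = γ * (1 / 2) by ring, Real.rpow_mul hn'.le, ← Real.sqrt_eq_rpow]
      exact Real.sqrt_le_sqrt (Nat.le_ceil _)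
    have hpow : (n : ℝ) ^ ε = (n : ℝ) ^ ((ε - 1 / 2) / 2) * (n : ℝ) ^ (γ / 2) := by
      rw [← Real.rpow_add hn']; congr 1; rw [hγ]; ring
    rw [div_le_iff₀ (lt_of_lt_of_le (Real.rpow_pos_of_pos hn' _) hsM)]
    calc (w : ℝ) + z ≤ 2 * K * (n : ℝ) ^ ε := by linarith
      _ = 2 * K * (n : ℝ) ^ ((ε - 1 / 2) / 2) * (n : ℝ) ^ (γ / 2) := by rw [hpow]; ring
      _ ≤ _ := by gcongr
  have hden := hq 0 hM1 ((z : ℤ) - w) (by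
    push_cast
    have h1 : (0 : ℝ) < w := by exact_mod_cast hw0
    have h2 : (0 : ℝ) < z := by exact_mod_cast hz0
    rw [abs_le]; constructor <;> linarith)
  simp only [Nat.sub_zero] at hden
  set X := (renewal p w).toReal * (renewal p z).toReal with hX
  have hX0 : 0 < X := mul_pos (hpos w hw0) (hpos z hz0)
  set A := n * √n * (killedPow p n w z).toReal / X with hA
  set Q := (stepPow p n ((z : ℤ) - w)).toReal * √n with hQ
  have hQ0 : κ / 2 ≤ Q := by linarith [(abs_le.1 hden).1]
  have hQpos : 0 < Q := by linarith
  have hq0 : (stepPow p n ((z : ℤ) - w)).toReal ≠ 0 := by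
    intro h
    rw [hQ, h, zero_mul] at hQpos
    exact lt_irrefl _ hQpos
  have hratio : (killedPow p n w z).toReal / (X / n * (stepPow p n ((z : ℤ) - w)).toReal)
      = A / Q := by
    rw [hA, hQ]; field_simp
  rw [hratio, div_sub' hQpos.ne', abs_div, abs_of_pos hQpos, div_lt_iff₀ hQpos]
  have hAQ : |A - Q * c| ≤ (2 * c + 1) * δ := by
    calc |A - Q * c| = |(A - κ * c) - c * (Q - κ)| := by ring_nf
      _ ≤ |A - κ * c| + |c * (Q - κ)| := abs_sub _ _
      _ ≤ (δ * c + δ) + c * δ := by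
          rw [abs_mul, abs_of_nonneg (by linarith : 0 ≤ c)]
          gcongr
          exact hmain.trans (by linarith)
      _ = _ := by ring
  calc |A - Q * c| ≤ δ₀ * κ / 4 := hAQ.trans hδc
    _ < δ₀ * (κ / 2) := by nlinarith [mul_pos hδ₀ hκ]
    _ ≤ δ₀ * Q := by gcongr
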